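/- Let $N = 2n$ with $n \ge 1$ an integer, let $Z > 0$, and let $\Omega_{nuc} \subset \mathbb{R}^3$ be compact. Let $e_{xc} : [0,\infty) \to \mathbb{R}$ be continuously differentiable with derivative $v_{xc} = e_{xc}'$ (one-sided at $0$), and assume that $e_{xc}(0) = v_{xc}(0) = 0$, that $v_{xc} \le 0$, that $|v_{xc}(\rho)| \le c_{xc}(1 + \rho^{p-1})$ for all $\rho \ge 0$, for some $p \in [1, \tfrac53)$ and $c_{xc} > 0$, and that $\limsup_{\rho \to 0+} e_{xc}(\rho)/\rho^{q} < 0$ for some $q \in [1, \tfrac32)$. Let $\mu$ be a nonnegative Radon measure carried by $\Omega_{nuc}$ with total mass $Z$, and let $\Phi = (\varphi_1, \dots, \varphi_n) \in H^1(\mathbb{R}^3;\mathbb{C})^n$ be $L^2$-orthonormal. Put $\rho = 2\sum_{k=1}^n |\varphi_k|^2$, $v_{ext}(x) = -\int |x-y|^{-1}\,d\mu(y)$, $v_H(x) = \int_{\mathbb{R}^3} \rho(y)|x-y|^{-1}\,dy$, and, for $\chi \in H^1(\mathbb{R}^3;\mathbb{C})$, $$\mathcal{E}_{\mu,\rho}[\chi]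 = \tfrac12 \int_{\mathbb{R}^3} |\nabla \chi|^2 + \int_{\mathbb{R}^3} \big(v_{ext} + v_H + v_{xc}(\rho)\big)|\chi|^2 .$$ Then $\mathcal{E}_{\mu,\rho}$ has a maximizer on $\{\chi \in \mathrm{Span}_{\mathbb{C}}\{\varphi_1,\dots,\varphi_n\} : \|\chi\|_{L^2} = 1\}$ (a HOMO). If, in addition, $Z > N$ and there is $\gamma > 0$ such that $e^{\gamma|\cdot|}\varphi_j \in H^1(\mathbb{R}^3)$ for all $j \in \{1,\dots,n\}$, then $\mathcal{E}_{\mu,\rho}$ also has a minimizer on $\{\chi \in H^1(\mathbb{R}^3;\mathbb{C}) : \langle \varphi_k, \chi\rangle_{L^2} = 0 \text{ for } k = 1,\dots,n,\ \|\chi\|_{L^2} = 1\}$ (a LUMO). -/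

import Mathlib

open MeasureTheory Filter Topology Set
open scoped ENNReal SchwartzMap LineDeriv

noncomputable section

namespace KohnSham

/-- Euclidean space `ℝ³`. -/
abbrev E3 : Type := EuclideanSpace ℝ (Fin 3)

/-- The complex Hilbert space `L²(ℝ³; ℂ)`. -/
abbrev L2 : Type := Lp ℂ 2 (volume : Measure E3)

/-- The Sobolev space `H¹(ℝ³)`, as a subspace of `L²(ℝ³)`. -/
def H1 : Submodule ℂ L2 where
  carrier := {u | TemperedDistribution.MemSobolev 1 2 (u : 𝓢'(E3, ℂ))}
  add_mem' {u v} hu hv := by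
    have h := TemperedDistribution.MemSobolev.add hu hv
    have e := (Lp.toTemperedDistributionCLM ℂ (volume : Measure E3) 2).map_add u v
    simp only [Lp.toTemperedDistributionCLM_apply] at e
    simpa only [mem_ofPred_eq, e] using h
  zero_mem' := by
    have e := (Lp.toTemperedDistributionCLM ℂ (volume : Measure E3) 2).map_zero
    simp only [Lp.toTemperedDistributionCLM_apply] at e
    simpa only [mem_ofPred_eq, e] using TemperedDistribution.memSobolev_fun_zero E3 ℂ 1 2
  smul_mem' c u hu := by
    have h := TemperedDistribution.MemSobolev.smul c hu
    have e := (Lp.toTemperedDistributionCLM ℂ (volume : Measure E3) 2).map_smul c u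
    simp only [Lp.toTemperedDistributionCLM_apply] at e
    simpa only [mem_ofPred_eq, e] using h

/-- `g ∈ L²(ℝ³)` is the `i`-th weak partial derivative of `u ∈ L²(ℝ³)`: the distributional
derivative of `u` in the `i`-th coordinate direction is (the distribution given by) `g`. -/
def IsWeakPartial (i : Fin 3) (u g : L2) : Prop :=
  ∂_{(EuclideanSpace.single i (1 : ℝ) : E3)} (u : 𝓢'(E3, ℂ)) = (g : 𝓢'(E3, ℂ))

theorem exists_isWeakPartial (i : Fin 3) {u : L2} (hu : u ∈ H1) : ∃ g, IsWeakPartial i u g := by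
  have h := TemperedDistribution.MemSobolev.lineDerivOp
    (m := (EuclideanSpace.single i (1 : ℝ) : E3)) hu
  rw [sub_self, TemperedDistribution.memSobolev_zero_iff] at h
  exact h

theorem IsWeakPartial.unique {i : Fin 3} {u g g' : L2} (h : IsWeakPartial i u g)
    (h' : IsWeakPartial i u g') : g = g' := by
  have k := LinearMap.ker_eq_bot.1
    (Lp.ker_toTemperedDistributionCLM_eq_bot (F := ℂ) (μ := (volume : Measure E3)) (p := 2))
  exact k (h.symm.trans h')

open Classical in
/-- The `i`-th weak partial derivative `∂ᵢ u ∈ L²(ℝ³)`; it is used only for `u ∈ H¹(ℝ³)`, where it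
exists and is unique. -/
def weakPartial (i : Fin 3) (u : L2) : L2 :=
  if h : ∃ g, IsWeakPartial i u g then h.choose else 0

theorem isWeakPartial_weakPartial (i : Fin 3) {u : L2} (hu : u ∈ H1) :
    IsWeakPartial i u (weakPartial i u) := by
  rw [weakPartial, dif_pos (exists_isWeakPartial i hu)]
  exact (exists_isWeakPartial i hu).choose_spec

/-- The exchange-correlation potential `v_xc = d e_xc / dρ` on `[0, ∞)` (one-sided at `0`). -/
def vxc (exc : ℝ → ℝ) (ρ : ℝ) : ℝ := derivWithin exc (Ici 0) ρ

/-- The assumptions on the exchange-correlation energy density `e_xc : [0, ∞) → ℝ`. Only the values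
of `exc` on `[0, ∞)` matter. -/
structure AdmissibleXC (exc : ℝ → ℝ) : Prop where
  contDiffOn : ContDiffOn ℝ 1 exc (Ici 0)
  exc_zero : exc 0 = 0
  vxc_zero : vxc exc 0 = 0
  vxc_nonpos : ∀ ρ, 0 ≤ ρ → vxc exc ρ ≤ 0
  growth : ∃ p : ℝ, 1 ≤ p ∧ p < 5 / 3 ∧ ∃ c : ℝ, 0 < c ∧
    ∀ ρ, 0 ≤ ρ → |vxc exc ρ| ≤ c * (1 + ρ ^ (p - 1))
  near_zero : ∃ q : ℝ, 1 ≤ q ∧ q < 3 / 2 ∧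
    limsup (fun ρ : ℝ => ((exc ρ / ρ ^ q : ℝ) : EReal)) (𝓝[>] 0) < 0

/-- The admissible nuclear charge distributions: nonnegative (Radon) measures carried by `Ω`, of
total mass `Z`. -/
def Anuc (Ω : Set E3) (Z : ℝ) : Set (Measure E3) :=
  {μ | μ Ωᶜ = 0 ∧ μ univ = ENNReal.ofReal Z}

variable {n : ℕ}

/-- The admissible orbitals: `L²`-orthonormal `n`-tuples in `H¹(ℝ³)`. -/
def orbitalSet (n : ℕ) : Set (Fin n → L2) :=
  {Φ | (∀ k, Φ k ∈ H1) ∧ Orthonormal ℂ Φ}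

/-- The electron density `ρ = 2 ∑ₖ |φₖ|²`. -/
def density (Φ : Fin n → L2) (x : E3) : ℝ := 2 * ∑ k, ‖Φ k x‖ ^ 2

/-- The nuclear potential `v_ext(x) = -∫ |x - y|⁻¹ dμ(y)`. -/
def vext (μ : Measure E3) (x : E3) : ℝ := -∫ y, 1 / ‖x - y‖ ∂μ

/-- The Hartree potential `v_H(x) = ∫ ρ(y) |x - y|⁻¹ dy`. -/
def vHartree (ρ : E3 → ℝ) (x : E3) : ℝ := ∫ y, ρ y / ‖x - y‖

/-- The excitation energy functional
`χ ↦ ⟨χ, h_{μ,ρ} χ⟩ = ½ ∫ |∇χ|² + ∫ (v_ext + v_H + v_xc(ρ)) |χ|²` on `H¹(ℝ³)`. -/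
def excitationEnergy (exc : ℝ → ℝ) (μ : Measure E3) (ρ : E3 → ℝ) (χ : L2) : ℝ :=
  1 / 2 * (∫ x, ∑ i, ‖weakPartial i χ x‖ ^ 2) +
    ∫ x, (vext μ x + vHartree ρ x + vxc exc (ρ x)) * ‖χ x‖ ^ 2

/-- The unit vectors in the span of the orbitals. -/
def homoSet (Φ : Fin n → L2) : Set L2 :=
  {χ | χ ∈ Submodule.span ℂ (range Φ) ∧ ‖χ‖ = 1}

/-- The `L²`-unit vectors in `H¹(ℝ³)` that are orthogonal to the orbitals. -/
def lumoSet (Φ : Fin n → L2) : Set L2 :=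
  {χ | χ ∈ H1 ∧ (∀ k, inner ℂ (Φ k) χ = 0) ∧ ‖χ‖ = 1}

/-- Exponential decay: for some `γ > 0`, `e^{γ|x|} φⱼ ∈ H¹(ℝ³)` for all `j`. -/
def ExpDecay (Φ : Fin n → L2) : Prop :=
  ∃ γ : ℝ, 0 < γ ∧ ∀ j, ∃ u ∈ H1,
    (u : E3 → ℂ) =ᵐ[volume] fun x => (Real.exp (γ * ‖x‖) : ℂ) * Φ j x

end KohnSham

end

open MeasureTheory Filter Topology Set
open scoped ENNReal SchwartzMap LineDeriv

noncomputable section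

namespace KohnSham

open FourierTransform TemperedDistribution
open scoped Real NNReal

section

/-! ### Fourier multipliers on `L²(ℝ³)` -/

/-! Write `χ = bessel f`, where `bessel` is the Fourier multiplier `(1 + |ξ|²)^(-1/2)`. Then `f`
ranges over all of `L²`, `‖f‖` serves as the `H¹` norm of `χ`, and Plancherel gives `∫ |∇χ|² = 4π²
(‖f‖² - ‖χ‖²)`. The energy becomes `energyForm`, a quadratic form on the Hilbert space `L²`.

The potential is a compact perturbation in the sense of `IsFormSmall`: up to `ε ‖f‖²`, its form is
controlled by the mass of `χ` on a set of finite measure. For the two Coulomb terms and for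
`v_xc(ρ)` this rests on Hölder and the Sobolev embedding into `L⁶`. A Rellich-type argument
(`tendsto_setIntegral_bessel`) then makes the potential form weakly sequentially continuous, while
the kinetic form is weakly lower semicontinuous.

The HOMO maximizes a continuous function over a compact sphere in a finite-dimensional span. For the
LUMO, a minimizing sequence is bounded in `H¹`; its weak limit stays orthogonal to the orbitals and
has energy at most the infimum `m`, but it may lose mass. If `m < 0` this cannot happen: the limit
is nonzero, and rescaling it to unit norm would push the energy below `m`
(`exists_isMinOn_lumoSet`).

Negativity of `m` (`exists_lumoSet_neg`) comes from the spread-out trial functions `s³ η(s² x)`;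
dilating by `s²` keeps the normalising factor an integer power. Their kinetic energy is of order
`s⁴`, their Coulomb energy is asymptotic to `s² (N - Z)` times a positive constant, and `v_xc ≤ 0`
can be dropped. The orbitals are integrable thanks to exponential decay, so projecting them out
changes the trial function only by `O(s³)` in `H¹`. For small `s` the negative `s²` term wins. -/

/-- Multiplication by a bounded function, as an operator on `L²(ℝ³)`. -/
def mulOp (g : E3 → ℂ) (hg : MemLp g ∞ (volume : Measure E3)) : L2 →L[ℂ] L2 :=
  (ContinuousLinearMap.mul ℂ ℂ).holderL volume ∞ 2 2 (hg.toLp g)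

theorem coeFn_mulOp (g : E3 → ℂ) (hg : MemLp g ∞ (volume : Measure E3)) (f : L2) :
    mulOp g hg f =ᵐ[volume] fun x => g x * f x := by
  have h := (ContinuousLinearMap.mul ℂ ℂ).coeFn_holder (r := 2) (hg.toLp g) f
  filter_upwards [h, hg.coeFn_toLp] with x hx hx'
  change ((ContinuousLinearMap.mul ℂ ℂ).holder 2 (hg.toLp g) f : E3 → ℂ) x = _
  rw [hx, hx']; rfl

/-- The Fourier multiplier with a bounded symbol, as an operator on `L²(ℝ³)`. -/
def fourierMul (g : E3 → ℂ) (hg : MemLp g ∞ (volume : Measure E3)) : L2 →L[ℂ] L2 :=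
  (Lp.fourierTransformₗᵢ E3 ℂ).symm.toContinuousLinearEquiv.toContinuousLinearMap ∘L
    mulOp g hg ∘L (Lp.fourierTransformₗᵢ E3 ℂ).toContinuousLinearEquiv.toContinuousLinearMap

theorem fourierMul_apply (g : E3 → ℂ) (hg : MemLp g ∞ (volume : Measure E3)) (f : L2) :
    fourierMul g hg f = 𝓕⁻ (mulOp g hg (𝓕 f)) := rfl

theorem fourier_fourierMul (g : E3 → ℂ) (hg : MemLp g ∞ (volume : Measure E3)) (f : L2) :
    𝓕 (fourierMul g hg f) = mulOp g hg (𝓕 f) := by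
  rw [fourierMul_apply, fourier_fourierInv_eq]

theorem norm_sq_eq_integral (f : L2) : ‖f‖ ^ 2 = ∫ x, ‖f x‖ ^ 2 := by
  have h := L2.inner_def (𝕜 := ℂ) f f
  rw [inner_self_eq_norm_sq_to_K] at h
  have h2 : ∀ x, inner ℂ (f x) (f x) = (((‖f x‖ ^ 2 : ℝ)) : ℂ) := fun x => by
    rw [inner_self_eq_norm_sq_to_K]; norm_cast
  simp_rw [h2] at h
  rw [integral_complex_ofReal] at h
  exact Complex.ofReal_injective (by push_cast at h ⊢; exact h)

theorem integrable_norm_sq (f : L2) : Integrable (fun x => ‖f x‖ ^ 2) volume :=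
  (Lp.memLp f).integrable_norm_pow (p := 2) (by norm_num)

theorem norm_sq_fourierMul (g : E3 → ℂ) (hg : MemLp g ∞ (volume : Measure E3)) (f : L2) :
    ‖fourierMul g hg f‖ ^ 2 = ∫ ξ, ‖g ξ‖ ^ 2 * ‖(𝓕 f : L2) ξ‖ ^ 2 := by
  rw [← Lp.norm_fourier_eq, fourier_fourierMul, norm_sq_eq_integral]
  refine integral_congr_ae ?_
  filter_upwards [coeFn_mulOp g hg (𝓕 f)] with x hx
  rw [hx, norm_mul, mul_pow]

theorem integrable_sq_mul_fourier (g : E3 → ℂ) (hg : MemLp g ∞ (volume : Measure E3)) (f : L2) :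
    Integrable (fun ξ => ‖g ξ‖ ^ 2 * ‖(𝓕 f : L2) ξ‖ ^ 2) volume := by
  refine (integrable_norm_sq (mulOp g hg (𝓕 f))).congr ?_
  filter_upwards [coeFn_mulOp g hg (𝓕 f)] with x hx
  rw [hx, norm_mul, mul_pow]

/-- Bridge between operators on `L²` and multipliers on tempered distributions, in terms of which
`H1` and `IsWeakPartial` are defined. -/
theorem toTemperedDistribution_fourierMul (g : E3 → ℂ) (hg : MemLp g ∞ (volume : Measure E3))
    (hg' : g.HasTemperateGrowth) (f : L2) :
    ((fourierMul g hg f : L2) : 𝓢'(E3, ℂ)) = fourierMultiplierCLM ℂ g (f : 𝓢'(E3, ℂ)) := by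
  have e : mulOp g hg (𝓕 f) = ((hg.toLp g) • (𝓕 f : L2) : L2) := by
    ext1
    filter_upwards [coeFn_mulOp g hg (𝓕 f), Lp.coeFn_lpSMul (r := 2) (hg.toLp g) (𝓕 f : L2),
      hg.coeFn_toLp] with x h1 h2 h3
    rw [h1, h2, Pi.smul_apply', h3]; rfl
  rw [fourierMul_apply, ← Lp.fourierInv_toTemperedDistribution_eq, e,
    Lp.toTemperedDistribution_smul_eq hg' hg, fourierMultiplierCLM_apply,
    Lp.fourier_toTemperedDistribution_eq]

theorem toTemperedDistribution_injective {f g : L2}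
    (h : (f : 𝓢'(E3, ℂ)) = (g : 𝓢'(E3, ℂ))) : f = g :=
  LinearMap.ker_eq_bot.1
    (Lp.ker_toTemperedDistributionCLM_eq_bot (F := ℂ) (μ := (volume : Measure E3)) (p := 2)) h

/-! ### The Bessel potential of order `-1` -/

/-- The symbol `(1 + |ξ|²)^(-1/2)`. -/
def besselSymbol (ξ : E3) : ℂ := (((1 + ‖ξ‖ ^ 2) ^ (-1 / 2 : ℝ) : ℝ) : ℂ)

/-- The symbol `2πi ξᵢ (1 + |ξ|²)^(-1/2)`. -/
def rieszSymbol (i : Fin 3) (ξ : E3) : ℂ := 2 * π * Complex.I * ((ξ i : ℝ) * besselSymbol ξ)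

theorem norm_sq_besselSymbol (ξ : E3) : ‖besselSymbol ξ‖ ^ 2 = (1 + ‖ξ‖ ^ 2)⁻¹ := by
  have h : (0 : ℝ) < 1 + ‖ξ‖ ^ 2 := by positivity
  rw [besselSymbol, Complex.norm_real, Real.norm_eq_abs, sq_abs, ← Real.rpow_natCast,
    ← Real.rpow_mul h.le]
  norm_num [Real.rpow_neg_one]

theorem norm_sq_rieszSymbol (i : Fin 3) (ξ : E3) :
    ‖rieszSymbol i ξ‖ ^ 2 = 4 * π ^ 2 * (ξ i) ^ 2 * (1 + ‖ξ‖ ^ 2)⁻¹ := by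
  rw [rieszSymbol, norm_mul, norm_mul, norm_mul _ (besselSymbol ξ), mul_pow, mul_pow, mul_pow,
    norm_sq_besselSymbol]
  simp [abs_of_pos Real.pi_pos]
  ring

/-- Since `|ξ|² / (1 + |ξ|²) = 1 - 1 / (1 + |ξ|²)`, the symbol of the kinetic energy is a constant
minus the squared Bessel symbol. This is the source of the kinetic identity. -/
theorem sum_norm_sq_rieszSymbol (ξ : E3) :
    ∑ i, ‖rieszSymbol i ξ‖ ^ 2 = 4 * π ^ 2 * (1 - ‖besselSymbol ξ‖ ^ 2) := by
  have h : (0 : ℝ) < 1 + ‖ξ‖ ^ 2 := by positivity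
  simp_rw [norm_sq_rieszSymbol, norm_sq_besselSymbol, ← Finset.sum_mul, ← Finset.mul_sum]
  have : ∑ i, (ξ i) ^ 2 = ‖ξ‖ ^ 2 := by
    rw [EuclideanSpace.norm_sq_eq]; simp
  rw [this]
  field_simp
  ring

theorem hasTemperateGrowth_besselSymbol : besselSymbol.HasTemperateGrowth := by
  unfold besselSymbol; fun_prop

theorem hasTemperateGrowth_rieszSymbol (i : Fin 3) : (rieszSymbol i).HasTemperateGrowth := by
  have h : (fun ξ : E3 => (((inner ℝ ξ (EuclideanSpace.single i (1 : ℝ)) : ℝ)) : ℂ)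
      ).HasTemperateGrowth := by fun_prop
  have e : rieszSymbol i = fun ξ => (2 * π * Complex.I) *
      ((((inner ℝ ξ (EuclideanSpace.single i (1 : ℝ)) : ℝ)) : ℂ) * besselSymbol ξ) := by
    ext ξ; simp [rieszSymbol, EuclideanSpace.inner_single_right]
  have := hasTemperateGrowth_besselSymbol
  rw [e]; fun_prop

theorem norm_besselSymbol_le_one (ξ : E3) : ‖besselSymbol ξ‖ ≤ 1 := by
  have h := norm_sq_besselSymbol ξ
  have h2 : (1 + ‖ξ‖ ^ 2)⁻¹ ≤ 1 := inv_le_one_of_one_le₀ (by nlinarith [norm_nonneg ξ])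
  nlinarith [norm_nonneg (besselSymbol ξ)]

theorem norm_rieszSymbol_le (i : Fin 3) (ξ : E3) : ‖rieszSymbol i ξ‖ ≤ 2 * π := by
  have h := sum_norm_sq_rieszSymbol ξ
  have h2 := Finset.single_le_sum (f := fun i => ‖rieszSymbol i ξ‖ ^ 2) (fun _ _ => by positivity)
    (Finset.mem_univ i)
  refine le_of_sq_le_sq ?_ (by positivity)
  nlinarith [sq_nonneg ‖besselSymbol ξ‖, Real.pi_pos,
    mul_nonneg (sq_nonneg π) (sq_nonneg ‖besselSymbol ξ‖)]

theorem memLp_besselSymbol : MemLp besselSymbol ∞ (volume : Measure E3) :=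
  memLp_top_of_bound hasTemperateGrowth_besselSymbol.1.continuous.aestronglyMeasurable 1
    (Eventually.of_forall norm_besselSymbol_le_one)

theorem memLp_rieszSymbol (i : Fin 3) : MemLp (rieszSymbol i) ∞ (volume : Measure E3) :=
  memLp_top_of_bound (hasTemperateGrowth_rieszSymbol i).1.continuous.aestronglyMeasurable (2 * π)
    (Eventually.of_forall (norm_rieszSymbol_le i))

/-- The Bessel potential `(1 - (2π)⁻² Δ)^(-1/2)` on `L²(ℝ³)`; its range is `H¹(ℝ³)`. -/
def bessel : L2 →L[ℂ] L2 := fourierMul besselSymbol memLp_besselSymbol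

theorem toTemperedDistribution_bessel (f : L2) :
    ((bessel f : L2) : 𝓢'(E3, ℂ)) = besselPotential E3 ℂ (-1) (f : 𝓢'(E3, ℂ)) := by
  rw [bessel, toTemperedDistribution_fourierMul _ _ hasTemperateGrowth_besselSymbol]; rfl

theorem bessel_injective : Function.Injective bessel := by
  intro f g h
  have h' := congrArg (fun u : L2 => besselPotential E3 ℂ 1 (u : 𝓢'(E3, ℂ))) h
  simp only [toTemperedDistribution_bessel, besselPotential_besselPotential_apply,
    neg_add_cancel, besselPotential_zero] at h'
  exact toTemperedDistribution_injective h'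

/-- Bessel potentials of opposite orders cancel. This parametrises `H¹` by `L²` and replaces Sobolev
norms by `‖f‖`. -/
theorem mem_H1_iff {u : L2} : u ∈ H1 ↔ ∃ f, bessel f = u := by
  constructor
  · rintro ⟨f, hf⟩
    refine ⟨f, toTemperedDistribution_injective ?_⟩
    rw [toTemperedDistribution_bessel, besselPotential_neg_apply_eq_iff, hf]
  · rintro ⟨f, rfl⟩
    refine ⟨f, ?_⟩
    rw [toTemperedDistribution_bessel, besselPotential_besselPotential_apply]
    simp

theorem bessel_mem_H1 (f : L2) : bessel f ∈ H1 := mem_H1_iff.2 ⟨f, rfl⟩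

theorem isWeakPartial_bessel (i : Fin 3) (f : L2) :
    IsWeakPartial i (bessel f) (fourierMul (rieszSymbol i) (memLp_rieszSymbol i) f) := by
  have h : (fun ξ : E3 => (((inner ℝ ξ (EuclideanSpace.single i (1 : ℝ)) : ℝ)) : ℂ)
      ).HasTemperateGrowth := by fun_prop
  rw [IsWeakPartial, lineDeriv_eq_fourierMultiplierCLM, bessel,
    toTemperedDistribution_fourierMul _ _ hasTemperateGrowth_besselSymbol,
    toTemperedDistribution_fourierMul _ _ (hasTemperateGrowth_rieszSymbol i),
    fourierMultiplierCLM_fourierMultiplierCLM_apply hasTemperateGrowth_besselSymbol h,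
    mul_comm besselSymbol]
  have e : rieszSymbol i = (2 * π * Complex.I) •
      ((fun ξ : E3 => (((inner ℝ ξ (EuclideanSpace.single i (1 : ℝ)) : ℝ)) : ℂ)) * besselSymbol)
      := by
    ext ξ; simp [rieszSymbol, EuclideanSpace.inner_single_right]
  rw [e, fourierMultiplierCLM_smul (h.mul hasTemperateGrowth_besselSymbol)]
  rfl

theorem weakPartial_eq {i : Fin 3} {u g : L2} (h : IsWeakPartial i u g) : weakPartial i u = g := by
  have hex : ∃ g, IsWeakPartial i u g := ⟨g, h⟩
  rw [weakPartial, dif_pos hex]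
  exact hex.choose_spec.unique h

/-- The kinetic energy of `bessel f`. -/
theorem integral_sum_weakPartial_bessel (f : L2) :
    ∫ x, ∑ i, ‖weakPartial i (bessel f) x‖ ^ 2 = 4 * π ^ 2 * (‖f‖ ^ 2 - ‖bessel f‖ ^ 2) := by
  rw [integral_finsetSum _ (fun i _ => integrable_norm_sq _)]
  simp_rw [← norm_sq_eq_integral, weakPartial_eq (isWeakPartial_bessel _ f), norm_sq_fourierMul]
  rw [← integral_finsetSum _ (fun i _ => integrable_sq_mul_fourier _ (memLp_rieszSymbol i) f)]
  simp_rw [← Finset.sum_mul, sum_norm_sq_rieszSymbol]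
  rw [bessel, norm_sq_fourierMul, ← Lp.norm_fourier_eq f, norm_sq_eq_integral,
    ← integral_sub (integrable_norm_sq _) (integrable_sq_mul_fourier _ memLp_besselSymbol f),
    ← integral_const_mul]
  congr 1; ext ξ; ring

theorem norm_bessel_le (f : L2) : ‖bessel f‖ ≤ ‖f‖ := by
  have h := integral_sum_weakPartial_bessel f
  have h0 : 0 ≤ ∫ x, ∑ i, ‖weakPartial i (bessel f) x‖ ^ 2 :=
    integral_nonneg fun x => Finset.sum_nonneg fun i _ => by positivity
  rw [h] at h0
  have := nonneg_of_mul_nonneg_right h0 (by positivity)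
  exact le_of_sq_le_sq (by linarith) (norm_nonneg f)

end

section

/-! ### The Sobolev inequality -/

theorem eLpNorm_le_of_tendsto_ae {f : ℕ → E3 → ℂ} {g : E3 → ℂ} {p C : ℝ≥0∞}
    (hf : ∀ n, AEStronglyMeasurable (f n) volume) (hC : ∀ n, eLpNorm (f n) p volume ≤ C)
    (h : ∀ᵐ x, Tendsto (fun n => f n x) atTop (𝓝 (g x))) : eLpNorm g p volume ≤ C :=
  (Lp.eLpNorm_lim_le_liminf_eLpNorm hf g h).trans
    ((liminf_le_liminf (Eventually.of_forall hC)).trans (liminf_const C).le)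

theorem norm_le_sum_apply_single (T : E3 →L[ℝ] ℂ) :
    ‖T‖ ≤ ∑ i, ‖T (EuclideanSpace.single i 1)‖ := by
  refine T.opNorm_le_bound (Finset.sum_nonneg fun i _ => norm_nonneg _) fun x => ?_
  have hx : x = ∑ i, x i • (EuclideanSpace.single i (1 : ℝ) : E3) := by
    have := (EuclideanSpace.basisFun (Fin 3) ℝ).sum_repr x
    simpa using this.symm
  conv_lhs => rw [hx, map_sum]
  rw [Finset.sum_mul]
  refine (norm_sum_le _ _).trans (Finset.sum_le_sum fun i _ => ?_)
  rw [map_smul, norm_smul, mul_comm]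
  gcongr
  exact PiLp.norm_apply_le x i

/-- A smooth cutoff function, equal to `1` on the unit ball. -/
def cutoff : ContDiffBump (0 : E3) := ⟨1, 2, one_pos, one_lt_two⟩

theorem exists_norm_fderiv_cutoff_le : ∃ K : ℝ≥0, ∀ x, ‖fderiv ℝ cutoff x‖ ≤ K := by
  have hc : Continuous (fderiv ℝ cutoff) :=
    (cutoff.contDiff (n := 1)).continuous_fderiv one_ne_zero
  obtain ⟨K, hK⟩ := (cutoff.hasCompactSupport.fderiv (𝕜 := ℝ)).exists_bound_of_continuous hc
  exact ⟨K.toNNReal, fun x => (hK x).trans (Real.le_coe_toNNReal K)⟩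

/-- The Gagliardo–Nirenberg–Sobolev inequality is applied to truncations by `η(x / (n + 1))`.
Differentiating the cutoff costs at most `K |u|`, and Fatou removes the truncation. -/
theorem exists_eLpNorm_six_le_fderiv : ∃ C : ℝ≥0, ∀ u : 𝓢(E3, ℂ),
    eLpNorm u 6 volume ≤ C * (eLpNorm (fderiv ℝ u) 2 volume + eLpNorm u 2 volume) := by
  obtain ⟨K, hK⟩ := exists_norm_fderiv_cutoff_le
  set C := SNormLESNormFDerivOfEqConst ℂ (volume : Measure E3) ((2 : ℝ≥0) : ℝ)
  refine ⟨C * max 1 K, fun u => ?_⟩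
  have hu : ContDiff ℝ 1 u := u.smooth 1
  let c : ℕ → E3 → ℝ := fun n x => cutoff (((n : ℝ) + 1)⁻¹ • x)
  have hc : ∀ n, ContDiff ℝ 1 (c n) := fun n =>
    (cutoff.contDiff (n := 1)).comp (contDiff_const_smul _)
  have hcs : ∀ n, HasCompactSupport (c n) := fun n =>
    cutoff.hasCompactSupport.comp_smul (by positivity)
  refine eLpNorm_le_of_tendsto_ae (f := fun n => c n • ⇑u)
    (fun n => ((hc n).smul hu).continuous.aestronglyMeasurable) (fun n => ?_)
    (Eventually.of_forall fun x => ?_)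
  · have h1 := eLpNorm_le_eLpNorm_fderiv_of_eq (volume : Measure E3) (u := c n • ⇑u)
      (p := 2) (p' := 6) ((hc n).smul hu) (hcs n).smul_right (by norm_num) (by simp)
      (by simp; norm_num)
    have h2 : eLpNorm (fderiv ℝ (c n • ⇑u)) 2 volume ≤
        eLpNorm (fderiv ℝ u) 2 volume + K * eLpNorm u 2 volume := by
      have h3 : ∀ x, ‖fderiv ℝ (c n • ⇑u) x‖ ≤ ‖fderiv ℝ u x‖ + K * ‖u x‖ := fun x => by
        rw [fderiv_smul ((hc n).differentiable one_ne_zero x) (hu.differentiable one_ne_zero x)]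
        refine (norm_add_le _ _).trans (add_le_add ?_ ?_)
        · rw [norm_smul]
          refine mul_le_of_le_one_left (norm_nonneg _) ?_
          rw [Real.norm_eq_abs, abs_of_nonneg cutoff.nonneg]
          exact cutoff.le_one
        · rw [ContinuousLinearMap.norm_smulRight_apply, fderiv_comp_smul, norm_smul]
          gcongr
          refine (mul_le_of_le_one_left (norm_nonneg _) ?_).trans (hK _)
          rw [Real.norm_eq_abs, abs_of_nonneg (by positivity)]
          exact inv_le_one_of_one_le₀ (by linarith [Nat.cast_nonneg (α := ℝ) n])
      refine (eLpNorm_mono_real h3).trans ?_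
      refine (eLpNorm_add_le (hu.continuous_fderiv one_ne_zero).norm.aestronglyMeasurable
        (hu.continuous.norm.const_smul (K : ℝ)).aestronglyMeasurable (by norm_num)).trans ?_
      rw [eLpNorm_norm]
      gcongr
      have := eLpNorm_const_smul (K : ℝ) (fun x => ‖u x‖) 2 (volume : Measure E3)
      rw [eLpNorm_norm] at this
      refine this.le.trans ?_
      gcongr
      simp
    refine h1.trans ?_
    rw [ENNReal.coe_mul, mul_assoc]
    gcongr
    refine h2.trans ?_
    rw [mul_add, ENNReal.coe_max]
    gcongr
    · exact le_mul_of_one_le_left (by positivity) (by simp)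
    · exact le_max_right _ _
  · obtain ⟨m, hm⟩ := exists_nat_ge ‖x‖
    refine tendsto_const_nhds.congr' ?_
    filter_upwards [eventually_ge_atTop m] with n hn
    have : c n x = 1 := by
      refine cutoff.one_of_mem_closedBall ?_
      rw [mem_closedBall_zero_iff, norm_smul, Real.norm_eq_abs, abs_of_nonneg (by positivity)]
      change _ ≤ (1 : ℝ)
      have : (m : ℝ) ≤ n := by exact_mod_cast hn
      rw [inv_mul_le_iff₀ (by positivity)]
      linarith
    simp [this]

theorem isWeakPartial_toLp (i : Fin 3) (u : 𝓢(E3, ℂ)) :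
    IsWeakPartial i (u.toLp 2) ((∂_{(EuclideanSpace.single i (1 : ℝ) : E3)} u).toLp 2) := by
  rw [IsWeakPartial, Lp.toTemperedDistribution_toLp_eq, Lp.toTemperedDistribution_toLp_eq,
    lineDerivOp_toTemperedDistributionCLM_eq]

theorem norm_weakPartial_bessel_le (i : Fin 3) (f : L2) :
    ‖weakPartial i (bessel f)‖ ≤ 2 * π * ‖f‖ := by
  have h := integral_sum_weakPartial_bessel f
  rw [integral_finsetSum _ (fun i _ => integrable_norm_sq _)] at h
  simp_rw [← norm_sq_eq_integral] at h
  have h2 := Finset.single_le_sum (f := fun i => ‖weakPartial i (bessel f)‖ ^ 2)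
    (fun _ _ => by positivity) (Finset.mem_univ i)
  refine le_of_sq_le_sq ?_ (by positivity)
  nlinarith [mul_nonneg (sq_nonneg π) (sq_nonneg ‖bessel f‖)]

/-- The classical derivative is bounded by its three partial derivatives, which are also the weak
ones, and each of those is at most `2π ‖f‖` in `L²`. -/
theorem exists_eLpNorm_six_le_of_toLp_eq : ∃ C : ℝ≥0, ∀ (u : 𝓢(E3, ℂ)) (f : L2),
    u.toLp 2 = bessel f → eLpNorm u 6 volume ≤ C * ‖f‖ₑ := by
  obtain ⟨C, hC⟩ := exists_eLpNorm_six_le_fderiv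
  refine ⟨C * (3 * (2 * π).toNNReal + 1), fun u f huf => (hC u).trans ?_⟩
  rw [ENNReal.coe_mul, mul_assoc]
  gcongr
  have h0 : eLpNorm u 2 volume = ‖bessel f‖ₑ := by
    rw [← huf, Lp.enorm_def, eLpNorm_congr_ae (u.coeFn_toLp 2 volume)]
  have h1 : ∀ i, eLpNorm (fun x => ‖fderiv ℝ u x (EuclideanSpace.single i 1)‖) 2 volume ≤
      ((2 * π).toNNReal : ℝ≥0∞) * ‖f‖ₑ := fun i => by
    have e : (fun x => fderiv ℝ u x (EuclideanSpace.single i 1)) =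
        ⇑(∂_{(EuclideanSpace.single i (1 : ℝ) : E3)} u : 𝓢(E3, ℂ)) := by
      ext x; rw [SchwartzMap.lineDerivOp_apply_eq_fderiv]
    rw [eLpNorm_norm, e, ← eLpNorm_congr_ae (SchwartzMap.coeFn_toLp _ 2 volume), ← Lp.enorm_def,
      ← weakPartial_eq (isWeakPartial_toLp i u), huf]
    have := ENNReal.ofReal_le_ofReal (norm_weakPartial_bessel_le i f)
    rwa [ENNReal.ofReal_mul (by positivity), ofReal_norm, ofReal_norm] at this
  have h2 : eLpNorm (fderiv ℝ u) 2 volume ≤ 3 * ((2 * π).toNNReal : ℝ≥0∞) * ‖f‖ₑ := by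
    refine (eLpNorm_mono_real (fun x => norm_le_sum_apply_single (fderiv ℝ u x))).trans ?_
    have h3 := eLpNorm_sum_le (μ := (volume : Measure E3)) (p := 2) (s := Finset.univ)
      (f := fun (i : Fin 3) x => ‖fderiv ℝ u x (EuclideanSpace.single i 1)‖) (fun i _ =>
        ((((u.smooth 1).continuous_fderiv one_ne_zero).clm_apply
          continuous_const).norm).aestronglyMeasurable) (by norm_num)
    have e : (∑ i : Fin 3, fun x => ‖fderiv ℝ u x (EuclideanSpace.single i 1)‖) =
        fun x => ∑ i : Fin 3, ‖fderiv ℝ u x (EuclideanSpace.single i 1)‖ := by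
      ext x; simp
    rw [e] at h3
    refine h3.trans ((Finset.sum_le_sum fun i _ => h1 i).trans ?_)
    simp [mul_assoc]
  have h4 : ‖bessel f‖ₑ ≤ ‖f‖ₑ := by
    simpa only [ofReal_norm] using ENNReal.ofReal_le_ofReal (norm_bessel_le f)
  rw [h0]
  refine (add_le_add h2 h4).trans ?_
  push_cast
  rw [add_mul, one_mul]

/-- The Bessel symbol preserves Schwartz functions, so the inequality proved for them can be
extended by density. -/
theorem bessel_toLp (u : 𝓢(E3, ℂ)) :
    bessel (u.toLp 2) = (SchwartzMap.fourierMultiplierCLM ℂ besselSymbol u).toLp 2 := by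
  refine toTemperedDistribution_injective ?_
  rw [bessel, toTemperedDistribution_fourierMul _ _ hasTemperateGrowth_besselSymbol,
    Lp.toTemperedDistribution_toLp_eq, Lp.toTemperedDistribution_toLp_eq,
    fourierMultiplierCLM_toTemperedDistributionCLM_eq hasTemperateGrowth_besselSymbol]

/-- The Sobolev inequality `‖u‖_{L⁶} ≤ C ‖u‖_{H¹}` in `ℝ³`. -/
theorem exists_eLpNorm_six_bessel_le : ∃ C : ℝ≥0, ∀ f : L2,
    eLpNorm (bessel f) 6 volume ≤ C * ‖f‖ₑ := by
  obtain ⟨C, hC⟩ := exists_eLpNorm_six_le_of_toLp_eq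
  refine ⟨C, fun f => ?_⟩
  have hcl := (SchwartzMap.denseRange_toLpCLM (E := E3) (F := ℂ) (p := 2)
    (μ := (volume : Measure E3)) ENNReal.ofNat_ne_top) f
  obtain ⟨v, hv, hlim⟩ := mem_closure_iff_seq_limit.1 hcl
  choose u hu using hv
  have hu' : ∀ n, (u n).toLp 2 = v n := hu
  have hb : Tendsto (fun n => bessel (v n)) atTop (𝓝 (bessel f)) :=
    (bessel.continuous.tendsto f).comp hlim
  -- Along a subsequence the approximants converge almost everywhere, so Fatou passes the `L⁶` bound
  -- to the limit.
  obtain ⟨ns, hns, hae⟩ := (tendstoInMeasure_of_tendsto_Lp hb).exists_seq_tendsto_ae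
  have hlim' := hlim.comp hns.tendsto_atTop
  have key : ∀ n, eLpNorm (bessel (v n)) 6 volume ≤ C * ‖v n‖ₑ := fun n => by
    have e := bessel_toLp (u n)
    rw [← hu' n, e, eLpNorm_congr_ae (SchwartzMap.coeFn_toLp _ 2 volume)]
    exact hC _ _ e.symm
  refine (Lp.eLpNorm_lim_le_liminf_eLpNorm (fun n => Lp.aestronglyMeasurable (bessel (v (ns n))))
    _ hae).trans ?_
  refine (liminf_le_liminf (Eventually.of_forall fun n => key (ns n))).trans ?_
  have ht : Tendsto (fun n => (C : ℝ≥0∞) * ‖v (ns n)‖ₑ) atTop (𝓝 (C * ‖f‖ₑ)) :=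
    ENNReal.Tendsto.const_mul hlim'.enorm (Or.inr ENNReal.coe_ne_top)
  exact ht.liminf_eq.le

end

section

/-! ### Local compactness -/

/-- On `L¹ ∩ L²`, the inverse `L²` Fourier transform is given by the Fourier integral. -/
theorem coeFn_fourierInv_of_integrable (h : L2) (hi : Integrable h volume) :
    (𝓕⁻ h : L2) =ᵐ[volume] 𝓕⁻ (h : E3 → ℂ) := by
  have hcont : Continuous (𝓕⁻ (h : E3 → ℂ)) :=
    VectorFourier.fourierIntegral_continuous Real.continuous_fourierChar
      (by exact (continuous_inner.neg : Continuous fun p : E3 × E3 => -inner ℝ p.1 p.2)) hi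
  refine ae_eq_of_integral_contDiff_smul_eq ((Lp.memLp _).locallyIntegrable one_le_two)
    hcont.locallyIntegrable fun g hg hgs => ?_
  have hg₁ : HasCompactSupport (Complex.ofRealCLM ∘ g) := hgs.comp_left rfl
  have hg₂ : ContDiff ℝ ((⊤ : ℕ∞) : WithTop ℕ∞) (Complex.ofRealCLM ∘ g) := by fun_prop
  set G : 𝓢(E3, ℂ) := hg₁.toSchwartzMap hg₂ with hG
  have e1 : ∫ x, g x • (𝓕⁻ h : L2) x = ((𝓕⁻ h : L2) : 𝓢'(E3, ℂ)) G := by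
    rw [Lp.toTemperedDistribution_apply]; simp [hG]
  rw [e1, ← Lp.fourierInv_toTemperedDistribution_eq, TemperedDistribution.fourierInv_apply,
    Lp.toTemperedDistribution_apply, SchwartzMap.fourierInv_coe]
  -- Symmetry of the Fourier integral moves the transform from `h` to the test function, which needs
  -- only that both are integrable.
  have := VectorFourier.integral_fourierIntegral_smul_eq_flip (μ := (volume : Measure E3))
    (ν := (volume : Measure E3)) (L := -innerₗ E3) (f := G) (g := h)
    Real.continuous_fourierChar
    (by exact (continuous_inner.neg : Continuous fun p : E3 × E3 => -inner ℝ p.1 p.2))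
    G.integrable hi
  refine this.trans (integral_congr_ae (Eventually.of_forall fun x => ?_))
  have e2 : (-innerₗ E3).flip = -innerₗ E3 := by
    ext x y; simp [real_inner_comm]
  simp only [e2]
  simp only [hG]
  simp
  exact Or.inl rfl

theorem memLp_indicator_besselSymbol {T : Set E3} (hT : MeasurableSet T) :
    MemLp (T.indicator besselSymbol) ∞ (volume : Measure E3) := memLp_besselSymbol.indicator hT

/-- The high-frequency part of `bessel` is small. -/
theorem norm_fourierMul_compl_closedBall_le {R : ℝ} (hR : 0 ≤ R) (f : L2) :
    ‖fourierMul _ (memLp_indicator_besselSymbol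
      (Metric.isClosed_closedBall (x := (0 : E3)) (ε := R)).measurableSet.compl) f‖ ^ 2
      ≤ (1 + R ^ 2)⁻¹ * ‖f‖ ^ 2 := by
  rw [norm_sq_fourierMul, ← Lp.norm_fourier_eq f, norm_sq_eq_integral, ← integral_const_mul]
  refine integral_mono (integrable_sq_mul_fourier _ (memLp_indicator_besselSymbol
    (Metric.isClosed_closedBall (x := (0 : E3)) (ε := R)).measurableSet.compl) f)
    ((integrable_norm_sq _).const_mul _) fun ξ => ?_
  refine mul_le_mul_of_nonneg_right ?_ (by positivity)
  by_cases hξ : ξ ∈ (Metric.closedBall (0 : E3) R)ᶜ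
  · rw [indicator_of_mem hξ, norm_sq_besselSymbol]
    have h1 : R < ‖ξ‖ := by simpa using hξ
    gcongr
  · rw [indicator_of_notMem hξ]
    rw [norm_zero, zero_pow two_ne_zero]
    positivity

theorem bessel_eq_add_compl {T : Set E3} (hT : MeasurableSet T) (f : L2) :
    bessel f = fourierMul _ (memLp_indicator_besselSymbol hT) f +
      fourierMul _ (memLp_indicator_besselSymbol hT.compl) f := by
  rw [bessel, fourierMul_apply, fourierMul_apply, fourierMul_apply,
    ← FourierTransform.fourierInv_add]
  congr 1
  ext1
  filter_upwards [coeFn_mulOp _ memLp_besselSymbol (𝓕 f),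
    coeFn_mulOp _ (memLp_indicator_besselSymbol hT) (𝓕 f),
    coeFn_mulOp _ (memLp_indicator_besselSymbol hT.compl) (𝓕 f),
    Lp.coeFn_add (mulOp _ (memLp_indicator_besselSymbol hT) (𝓕 f))
      (mulOp _ (memLp_indicator_besselSymbol hT.compl) (𝓕 f))] with x h1 h2 h3 h4
  rw [h4, Pi.add_apply, h1, h2, h3, ← add_mul]
  congr 1
  exact (congrFun (indicator_self_add_compl T besselSymbol) x).symm

/-- The kernel of the low-frequency part of `bessel`. -/
theorem exists_kernel_fourierMul {T : Set E3} (hT : MeasurableSet T) (hT' : volume T ≠ ∞) :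
    ∃ (k : E3 → L2) (C : ℝ), (∀ x, ‖k x‖ ≤ C) ∧ ∀ f : L2,
      fourierMul _ (memLp_indicator_besselSymbol hT) f =ᵐ[volume] fun x => inner ℂ (k x) f := by
  have hcont : ∀ x : E3, Continuous fun ξ : E3 => ((𝐞 (inner ℝ ξ x) : Circle) : ℂ) := fun x => by
    fun_prop
  -- Conjugated, because the inner product conjugates its first slot. The truncation to `T` puts it
  -- in `L²` uniformly in `x`, and Plancherel turns the pairing with `f` into the inverse Fourier
  -- integral.
  let κ : E3 → E3 → ℂ := fun x => T.indicator fun ξ =>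
    (starRingEnd ℂ) (((𝐞 (inner ℝ ξ x) : Circle) : ℂ) * besselSymbol ξ)
  have hb : ∀ x ξ, ‖κ x ξ‖ ≤ T.indicator (fun _ => (1 : ℝ)) ξ := fun x ξ => by
    by_cases hξ : ξ ∈ T
    · simp only [κ, indicator_of_mem hξ, RCLike.norm_conj, norm_mul, Circle.norm_coe, one_mul]
      exact norm_besselSymbol_le_one ξ
    · simp [κ, indicator_of_notMem hξ]
  have h1 : MemLp (T.indicator (fun _ => (1 : ℝ))) 2 (volume : Measure E3) :=
    memLp_indicator_const 2 hT 1 (Or.inr hT')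
  have hκ : ∀ x, MemLp (κ x) 2 (volume : Measure E3) := fun x => by
    refine h1.mono' ?_ (Eventually.of_forall (hb x))
    exact ((Complex.continuous_conj.comp ((hcont x).mul
      hasTemperateGrowth_besselSymbol.1.continuous)).aestronglyMeasurable).indicator hT
  refine ⟨fun x => 𝓕⁻ ((hκ x).toLp (κ x) : L2), ‖h1.toLp _‖, fun x => ?_, fun f => ?_⟩
  · rw [← Lp.norm_fourier_eq, fourier_fourierInv_eq]
    refine Lp.norm_le_norm_of_ae_le ?_
    filter_upwards [(hκ x).coeFn_toLp, h1.coeFn_toLp] with ξ h2 h3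
    rw [h2, h3]
    exact (hb x ξ).trans (le_abs_self _)
  · have hmul := coeFn_mulOp _ (memLp_indicator_besselSymbol hT) (𝓕 f)
    have hint : Integrable (mulOp _ (memLp_indicator_besselSymbol hT) (𝓕 f)) volume := by
      have := (Lp.memLp (𝓕 f : L2)).integrable_mul h1.ofReal (p := 2) (q := 2) (𝕜 := ℂ)
      refine this.mono (Lp.aestronglyMeasurable _) ?_
      filter_upwards [hmul] with ξ hξ
      rw [hξ]
      by_cases hT : ξ ∈ T
      · simp only [indicator_of_mem hT, Pi.mul_apply, norm_mul]
        simpa using mul_le_of_le_one_left (norm_nonneg _) (norm_besselSymbol_le_one ξ)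
      · simp [indicator_of_notMem hT]
    rw [fourierMul_apply]
    refine (coeFn_fourierInv_of_integrable _ hint).trans (Eventually.of_forall fun x => ?_)
    beta_reduce
    rw [← Lp.inner_fourier_eq, fourier_fourierInv_eq, L2.inner_def, Real.fourierInv_eq]
    refine integral_congr_ae ?_
    filter_upwards [hmul, (hκ x).coeFn_toLp] with ξ h2 h3
    rw [h2, h3, Circle.smul_def]
    by_cases hT : ξ ∈ T
    · simp [κ, indicator_of_mem hT]
      ring
    · simp [κ, indicator_of_notMem hT]

/-- If `fₖ ⇀ 0` weakly in `L²`, then `bessel fₖ → 0` in `L²(S)` for `S` of finite measure. -/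
theorem tendsto_setIntegral_bessel {S : Set E3} (hS' : volume S ≠ ∞)
    {f : ℕ → L2} {B : ℝ} (hB : ∀ k, ‖f k‖ ≤ B)
    (hf : ∀ g : L2, Tendsto (fun k => inner ℂ g (f k)) atTop (𝓝 0)) :
    Tendsto (fun k => ∫ x in S, ‖bessel (f k) x‖ ^ 2) atTop (𝓝 0) := by
  have hB0 : 0 ≤ B := (norm_nonneg _).trans (hB 0)
  rw [Metric.tendsto_atTop]
  intro ε hε
  -- The frequency cutoff `m` makes the high-frequency mass `B² / (1 + m²)` smaller than `ε / 4`,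
  -- uniformly in the sequence.
  obtain ⟨m, hm⟩ := exists_nat_gt (4 * B ^ 2 / ε)
  have hmB : 2 * ((1 + (m : ℝ) ^ 2)⁻¹ * B ^ 2) < ε / 2 := by
    have h1 : (m : ℝ) ≤ 1 + (m : ℝ) ^ 2 := by nlinarith [sq_nonneg ((m : ℝ) - 1)]
    rw [div_lt_iff₀ hε] at hm
    rw [← div_eq_inv_mul, ← mul_div_assoc, div_lt_iff₀ (by positivity)]
    nlinarith
  have hT : MeasurableSet (Metric.closedBall (0 : E3) m) := Metric.isClosed_closedBall.measurableSet
  obtain ⟨k, C, hkC, hk⟩ := exists_kernel_fourierMul hT measure_closedBall_lt_top.ne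
  have hC0 : 0 ≤ C := (norm_nonneg _).trans (hkC 0)
  set low := fourierMul _ (memLp_indicator_besselSymbol hT)
  set high := fourierMul _ (memLp_indicator_besselSymbol hT.compl) with hhigh
  -- The low-frequency part is pointwise an inner product with a fixed vector, so weak convergence
  -- gives pointwise convergence. It is bounded by `C B`, and `S` has finite measure, so dominated
  -- convergence applies.
  have hlow : Tendsto (fun j => ∫ x in S, ‖low (f j) x‖ ^ 2) atTop (𝓝 0) := by
    have e : (0 : ℝ) = ∫ x in S, (0 : ℝ) := by simp
    rw [e]
    have : IsFiniteMeasure (volume.restrict S) := ⟨by simpa using hS'.lt_top⟩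
    refine tendsto_integral_of_dominated_convergence (fun _ => (C * B) ^ 2)
      (fun j => (integrable_norm_sq _).aestronglyMeasurable.restrict) (integrable_const _)
      (fun j => ?_) ?_
    · filter_upwards [ae_restrict_of_ae (hk (f j))] with x hx
      rw [hx, Real.norm_eq_abs, abs_of_nonneg (by positivity)]
      gcongr
      exact (norm_inner_le_norm _ _).trans (mul_le_mul (hkC x) (hB j) (norm_nonneg _) hC0)
    · filter_upwards [ae_restrict_of_ae (ae_all_iff.2 fun j => hk (f j))] with x hx
      simp_rw [hx]
      simpa using ((hf (k x)).norm.pow 2)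
  obtain ⟨j₀, hj₀⟩ := Metric.tendsto_atTop.1 hlow (ε / 4) (by positivity)
  refine ⟨j₀, fun j hj => ?_⟩
  have h1 := hj₀ j hj
  rw [Real.dist_eq, sub_zero, abs_of_nonneg (integral_nonneg fun x => by positivity)] at h1 ⊢
  have h2 : ∫ x in S, ‖bessel (f j) x‖ ^ 2 ≤
      ∫ x in S, (2 * ‖low (f j) x‖ ^ 2 + 2 * ‖high (f j) x‖ ^ 2) := by
    refine setIntegral_mono_ae (integrable_norm_sq _).integrableOn
      (((integrable_norm_sq _).const_mul 2).add
        ((integrable_norm_sq _).const_mul 2)).integrableOn ?_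
    have e := bessel_eq_add_compl hT (f j)
    rw [e]
    filter_upwards [Lp.coeFn_add (low (f j)) (high (f j))] with x hx
    rw [hx, Pi.add_apply]
    have := norm_add_le (low (f j) x) (high (f j) x)
    nlinarith [sq_nonneg (‖low (f j) x‖ - ‖high (f j) x‖),
      norm_nonneg (low (f j) x + high (f j) x)]
  rw [integral_add ((integrable_norm_sq _).const_mul 2).integrableOn
    ((integrable_norm_sq _).const_mul 2).integrableOn, integral_const_mul,
    integral_const_mul] at h2
  have h3 : ∫ x in S, ‖high (f j) x‖ ^ 2 ≤ (1 + (m : ℝ) ^ 2)⁻¹ * B ^ 2 := by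
    refine (setIntegral_le_integral (integrable_norm_sq _)
      (Eventually.of_forall fun x => by positivity)).trans ?_
    rw [← norm_sq_eq_integral]
    refine (norm_fourierMul_compl_closedBall_le m.cast_nonneg (f j)).trans ?_
    gcongr
    exact hB j
  linarith

end

section

/-! ### Potentials that are form-small with respect to the Laplacian -/

/-- The potential `V` is form-small: up to an arbitrarily small multiple of the `H¹`-norm, the
quadratic form of `|V|` is controlled by the `L²`-norm on a set of finite measure. -/
structure IsFormSmall (V : E3 → ℝ) : Prop where
  aestronglyMeasurable : AEStronglyMeasurable V volume
  bound : ∀ ε : ℝ, 0 < ε → ∃ S : Set E3, volume S ≠ ∞ ∧ ∃ M : ℝ, 0 ≤ M ∧ ∀ f : L2,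
    ∫⁻ x, ‖V x‖ₑ * ‖bessel f x‖ₑ ^ 2 ≤
      ENNReal.ofReal (ε * ‖f‖ ^ 2 + M * ∫ x in S, ‖bessel f x‖ ^ 2)

/-- The quadratic form of the potential `V`, as a function of `f = (1 - (2π)⁻² Δ)^(1/2) χ`. -/
def potForm (V : E3 → ℝ) (f : L2) : ℝ := ∫ x, V x * ‖bessel f x‖ ^ 2

theorem setIntegral_norm_sq_le (S : Set E3) (u : L2) : ∫ x in S, ‖u x‖ ^ 2 ≤ ‖u‖ ^ 2 := by
  rw [norm_sq_eq_integral]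
  exact setIntegral_le_integral (integrable_norm_sq _)
    (Eventually.of_forall fun x => by positivity)

theorem setIntegral_norm_sq_nonneg (S : Set E3) (u : L2) : 0 ≤ ∫ x in S, ‖u x‖ ^ 2 :=
  integral_nonneg fun x => by positivity

theorem enorm_mul_norm_sq (a : ℝ) (z : ℂ) : ‖a * ‖z‖ ^ 2‖ₑ = ‖a‖ₑ * ‖z‖ₑ ^ 2 := by
  rw [enorm_mul, enorm_pow, enorm_norm]

namespace IsFormSmall

variable {V W : E3 → ℝ}

theorem integrable (hV : IsFormSmall V) (f : L2) :
    Integrable (fun x => V x * ‖bessel f x‖ ^ 2) volume := by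
  refine ⟨hV.aestronglyMeasurable.mul (integrable_norm_sq _).aestronglyMeasurable, ?_⟩
  obtain ⟨S, -, M, -, h⟩ := hV.bound 1 one_pos
  rw [HasFiniteIntegral]
  simp_rw [enorm_mul_norm_sq]
  exact (h f).trans_lt ENNReal.ofReal_lt_top

theorem add (hV : IsFormSmall V) (hW : IsFormSmall W) : IsFormSmall (fun x => V x + W x) := by
  refine ⟨hV.aestronglyMeasurable.add hW.aestronglyMeasurable, fun ε hε => ?_⟩
  obtain ⟨S, hS, M, hM, h⟩ := hV.bound (ε / 2) (by positivity)
  obtain ⟨S', hS', M', hM', h'⟩ := hW.bound (ε / 2) (by positivity)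
  refine ⟨S ∪ S', (measure_union_lt_top hS.lt_top hS'.lt_top).ne, M + M', by positivity,
    fun f => ?_⟩
  have e : ∫⁻ x, ‖V x + W x‖ₑ * ‖bessel f x‖ₑ ^ 2 ≤
      ∫⁻ x, (‖V x‖ₑ * ‖bessel f x‖ₑ ^ 2 + ‖W x‖ₑ * ‖bessel f x‖ₑ ^ 2) := by
    refine lintegral_mono fun x => ?_
    rw [← add_mul]
    gcongr
    exact enorm_add_le _ _
  have hm : AEMeasurable (fun x => ‖V x‖ₑ * ‖bessel f x‖ₑ ^ 2) volume := by
    have := (hV.integrable f).aestronglyMeasurable.enorm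
    simpa only [enorm_mul_norm_sq] using this
  rw [lintegral_add_left' hm] at e
  refine e.trans ((add_le_add (h f) (h' f)).trans ?_)
  have h1 := setIntegral_norm_sq_nonneg S (bessel f)
  have h2 := setIntegral_norm_sq_nonneg S' (bessel f)
  rw [← ENNReal.ofReal_add (by positivity) (by positivity)]
  refine ENNReal.ofReal_le_ofReal ?_
  have h3 : ∫ x in S, ‖bessel f x‖ ^ 2 ≤ ∫ x in S ∪ S', ‖bessel f x‖ ^ 2 :=
    setIntegral_mono_set (integrable_norm_sq _).integrableOn
      (Eventually.of_forall fun x => by positivity) (subset_union_left.eventuallyLE)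
  have h4 : ∫ x in S', ‖bessel f x‖ ^ 2 ≤ ∫ x in S ∪ S', ‖bessel f x‖ ^ 2 :=
    setIntegral_mono_set (integrable_norm_sq _).integrableOn
      (Eventually.of_forall fun x => by positivity) (subset_union_right.eventuallyLE)
  nlinarith [mul_le_mul_of_nonneg_left h3 hM, mul_le_mul_of_nonneg_left h4 hM']

theorem abs (hV : IsFormSmall V) : IsFormSmall (fun x => |V x|) := by
  refine ⟨hV.aestronglyMeasurable.norm, fun ε hε => ?_⟩
  obtain ⟨S, hS, M, hM, h⟩ := hV.bound ε hε
  refine ⟨S, hS, M, hM, fun f => ?_⟩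
  simp_rw [← Real.norm_eq_abs, enorm_norm]
  exact h f

theorem neg (hV : IsFormSmall V) : IsFormSmall (fun x => -V x) := by
  refine ⟨hV.aestronglyMeasurable.neg, fun ε hε => ?_⟩
  obtain ⟨S, hS, M, hM, h⟩ := hV.bound ε hε
  exact ⟨S, hS, M, hM, fun f => by simpa only [enorm_neg] using h f⟩

theorem potForm_abs_nonneg (V : E3 → ℝ) (f : L2) : 0 ≤ potForm (fun x => |V x|) f :=
  integral_nonneg fun x => by positivity

theorem abs_potForm_le (V : E3 → ℝ) (f : L2) : |potForm V f| ≤ potForm (fun x => |V x|) f := by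
  refine abs_integral_le_integral_abs.trans (le_of_eq ?_)
  simp_rw [potForm, abs_mul, abs_pow, abs_norm]

theorem exists_potForm_abs_le (hV : IsFormSmall V) {ε : ℝ} (hε : 0 < ε) :
    ∃ S : Set E3, volume S ≠ ∞ ∧ ∃ M : ℝ, 0 ≤ M ∧ ∀ f : L2,
      potForm (fun x => |V x|) f ≤ ε * ‖f‖ ^ 2 + M * ∫ x in S, ‖bessel f x‖ ^ 2 := by
  obtain ⟨S, hS, M, hM, h⟩ := hV.bound ε hε
  refine ⟨S, hS, M, hM, fun f => ?_⟩
  have h1 := setIntegral_norm_sq_nonneg S (bessel f)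
  rw [potForm, integral_eq_lintegral_of_nonneg_ae (Eventually.of_forall fun x => by positivity)
    (hV.abs.integrable f).aestronglyMeasurable]
  refine ENNReal.toReal_le_of_le_ofReal (by positivity) ((le_of_eq ?_).trans (h f))
  refine lintegral_congr fun x => ?_
  rw [← enorm_mul_norm_sq, ← ofReal_norm]
  simp

theorem exists_potForm_abs_le_norm_sq (hV : IsFormSmall V) :
    ∃ C : ℝ, 0 ≤ C ∧ ∀ f : L2, potForm (fun x => |V x|) f ≤ C * ‖f‖ ^ 2 := by
  obtain ⟨S, -, M, hM, h⟩ := hV.exists_potForm_abs_le one_pos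
  refine ⟨1 + M, by positivity, fun f => (h f).trans ?_⟩
  have h1 := setIntegral_norm_sq_le S (bessel f)
  have h2 := norm_bessel_le f
  have h3 : ‖bessel f‖ ^ 2 ≤ ‖f‖ ^ 2 := by gcongr
  nlinarith [mul_le_mul_of_nonneg_left (h1.trans h3) hM]

theorem exists_neg_le_potForm (hV : IsFormSmall V) {ε : ℝ} (hε : 0 < ε) :
    ∃ M : ℝ, 0 ≤ M ∧ ∀ f : L2, -(ε * ‖f‖ ^ 2 + M * ‖bessel f‖ ^ 2) ≤ potForm V f := by
  obtain ⟨S, -, M, hM, h⟩ := hV.exists_potForm_abs_le hε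
  refine ⟨M, hM, fun f => ?_⟩
  have h1 := setIntegral_norm_sq_le S (bessel f)
  have h2 := (abs_le.1 (abs_potForm_le V f)).1
  nlinarith [h f, mul_le_mul_of_nonneg_left h1 hM]

/-- Boundedness of the sequence makes the `ε ‖f‖²` term uniformly small; the remaining mass on `S`
vanishes by local compactness. -/
theorem tendsto_potForm_abs (hV : IsFormSmall V) {f : ℕ → L2} {B : ℝ} (hB : ∀ k, ‖f k‖ ≤ B)
    (hf : ∀ g : L2, Tendsto (fun k => inner ℂ g (f k)) atTop (𝓝 0)) :
    Tendsto (fun k => potForm (fun x => |V x|) (f k)) atTop (𝓝 0) := by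
  have hB0 : 0 ≤ B := (norm_nonneg _).trans (hB 0)
  rw [Metric.tendsto_atTop]
  intro ε hε
  obtain ⟨S, hS, M, hM, h⟩ := hV.exists_potForm_abs_le (ε := ε / (2 * (B ^ 2 + 1))) (by positivity)
  have hlim := (tendsto_setIntegral_bessel hS hB hf).const_mul M
  rw [mul_zero] at hlim
  obtain ⟨k₀, hk₀⟩ := Metric.tendsto_atTop.1 hlim (ε / 2) (by positivity)
  refine ⟨k₀, fun k hk => ?_⟩
  have h1 := (abs_lt.1 ((Real.dist_eq _ _ ▸ hk₀ k hk : |_ - (0 : ℝ)| < _))).2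
  rw [Real.dist_eq, sub_zero, abs_of_nonneg (potForm_abs_nonneg V _)]
  refine (h (f k)).trans_lt ?_
  have h2 : ‖f k‖ ^ 2 ≤ B ^ 2 := by gcongr; exact hB k
  have h3 : ε / (2 * (B ^ 2 + 1)) * ‖f k‖ ^ 2 ≤ ε / 2 := by
    rw [div_mul_eq_mul_div, div_le_div_iff₀ (by positivity) (by positivity)]
    nlinarith
  linarith

/-- Pointwise Young inequality for the cross term `2 |a| |b|`. The parameter `δ` stays free: it is
taken small for weak continuity, and equal to `‖g‖` for the local Lipschitz bound. -/
theorem abs_potForm_add_sub_le (hV : IsFormSmall V) (f g : L2) {δ : ℝ} (hδ : 0 < δ) :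
    |potForm V (f + g) - potForm V f| ≤
      δ * potForm (fun x => |V x|) f + (1 + δ⁻¹) * potForm (fun x => |V x|) g := by
  simp only [potForm]
  rw [← integral_sub (hV.integrable _) (hV.integrable _), ← integral_const_mul,
    ← integral_const_mul, ← integral_add ((hV.abs.integrable _).const_mul _)
      ((hV.abs.integrable _).const_mul _)]
  refine abs_integral_le_integral_abs.trans (integral_mono_ae
    ((hV.integrable _).sub (hV.integrable _)).abs (((hV.abs.integrable _).const_mul _).add
      ((hV.abs.integrable _).const_mul _)) ?_)
  rw [map_add]
  filter_upwards [Lp.coeFn_add (bessel f) (bessel g)] with x hx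
  rw [hx, Pi.add_apply]
  set a := bessel f x
  set b := bessel g x
  rw [← mul_sub, abs_mul]
  have key : |‖a + b‖ ^ 2 - ‖a‖ ^ 2| ≤ δ * ‖a‖ ^ 2 + (1 + δ⁻¹) * ‖b‖ ^ 2 := by
    have h1 := norm_add_le a b
    have h2 := norm_sub_norm_le a (-b)
    rw [norm_neg, sub_neg_eq_add] at h2
    have h3 : 2 * (‖a‖ * ‖b‖) ≤ δ * ‖a‖ ^ 2 + δ⁻¹ * ‖b‖ ^ 2 := by
      have := sq_nonneg (δ * ‖a‖ - ‖b‖)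
      have h4 : 2 * (δ * (‖a‖ * ‖b‖)) ≤ δ * (δ * ‖a‖ ^ 2 + δ⁻¹ * ‖b‖ ^ 2) := by
        have : δ * (δ⁻¹ * ‖b‖ ^ 2) = ‖b‖ ^ 2 := by field_simp
        rw [mul_add, this]; nlinarith
      nlinarith
    have h5 := norm_nonneg a
    have h6 := norm_nonneg b
    have h7 := norm_nonneg (a + b)
    rw [abs_le]
    constructor
    · rcases le_total ‖b‖ ‖a‖ with h | h
      · nlinarith
      · nlinarith
    · nlinarith
  calc |V x| * |‖a + b‖ ^ 2 - ‖a‖ ^ 2|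
      ≤ |V x| * (δ * ‖a‖ ^ 2 + (1 + δ⁻¹) * ‖b‖ ^ 2) := by gcongr
    _ = _ := by ring

/-- The form of a form-small potential is weakly sequentially continuous on `H¹`. -/
theorem tendsto_potForm (hV : IsFormSmall V) {f : ℕ → L2} {f₀ : L2} {B : ℝ}
    (hB : ∀ k, ‖f k‖ ≤ B)
    (hf : ∀ g : L2, Tendsto (fun k => inner ℂ g (f k)) atTop (𝓝 (inner ℂ g f₀))) :
    Tendsto (fun k => potForm V (f k)) atTop (𝓝 (potForm V f₀)) := by
  have h0 := hV.tendsto_potForm_abs (f := fun k => f k - f₀) (B := B + ‖f₀‖)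
    (fun k => (norm_sub_le _ _).trans (by gcongr; exact hB k))
    (fun g => by simpa [inner_sub_right] using (hf g).sub_const (inner ℂ g f₀))
  have hN := potForm_abs_nonneg V f₀
  set N := potForm (fun x => |V x|) f₀
  rw [Metric.tendsto_atTop]
  intro ε hε
  have hδ : 0 < ε / (2 * (N + 1)) := by positivity
  set δ := ε / (2 * (N + 1)) with hδdef
  have h1 := h0.const_mul (1 + δ⁻¹)
  rw [mul_zero] at h1
  obtain ⟨k₀, hk₀⟩ := Metric.tendsto_atTop.1 h1 (ε / 2) (by positivity)
  refine ⟨k₀, fun k hk => ?_⟩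
  have h2 := (abs_lt.1 ((Real.dist_eq _ _ ▸ hk₀ k hk : |_ - (0 : ℝ)| < _))).2
  have h3 := hV.abs_potForm_add_sub_le f₀ (f k - f₀) hδ
  rw [add_sub_cancel] at h3
  rw [Real.dist_eq]
  have h4 : δ * N ≤ ε / 2 := by
    rw [hδdef, div_mul_eq_mul_div, div_le_div_iff₀ (by positivity) (by positivity)]
    nlinarith
  linarith

end IsFormSmall

/-- Hölder's and Sobolev's inequality: potentials in `L^{3/2}` are form-bounded. -/
theorem exists_lintegral_mul_bessel_le : ∃ C : ℝ≥0, ∀ (W : E3 → ℝ≥0∞), AEMeasurable W volume →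
    ∀ f : L2, ∫⁻ x, W x * ‖bessel f x‖ₑ ^ 2 ≤
      C * (∫⁻ x, W x ^ (3 / 2 : ℝ)) ^ (2 / 3 : ℝ) * ‖f‖ₑ ^ 2 := by
  obtain ⟨C, hC⟩ := exists_eLpNorm_six_bessel_le
  refine ⟨C ^ 2, fun W hW f => ?_⟩
  -- The `L³` norm of `|χ|²` is the square of the `L⁶` norm of `χ`, which is why `3 / 2` is the
  -- right exponent for the potential.
  have hpq : Real.HolderConjugate (3 / 2) 3 := by
    rw [Real.holderConjugate_iff]; norm_num
  have hm : AEMeasurable (fun x => ‖bessel f x‖ₑ ^ 2) volume :=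
    (Lp.aestronglyMeasurable (bessel f)).enorm.pow_const 2
  refine (ENNReal.lintegral_mul_le_Lp_mul_Lq volume hpq hW hm).trans ?_
  have h1 := hC f
  rw [eLpNorm_eq_lintegral_rpow_enorm_toReal (by norm_num) (by norm_num)] at h1
  have h2 : (∫⁻ x, (‖bessel f x‖ₑ ^ 2) ^ (3 : ℝ)) ^ (1 / (3 : ℝ)) ≤ (C * ‖f‖ₑ) ^ 2 := by
    refine le_trans (le_of_eq ?_) (pow_le_pow_left₀ zero_le h1 2)
    rw [← ENNReal.rpow_natCast _ 2, ← ENNReal.rpow_mul]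
    congr 1
    · refine lintegral_congr fun x => ?_
      rw [← ENNReal.rpow_natCast, ← ENNReal.rpow_mul]
      norm_num
    · norm_num
  calc _ ≤ (∫⁻ x, W x ^ (3 / 2 : ℝ)) ^ (1 / (3 / 2 : ℝ)) * (C * ‖f‖ₑ) ^ 2 := by gcongr
    _ = _ := by
      rw [mul_pow]; push_cast
      rw [show (1 / (3 / 2 : ℝ)) = 2 / 3 by norm_num]
      ring

theorem lintegral_enorm_sq_eq (S : Set E3) (u : L2) :
    ∫⁻ x in S, ‖u x‖ₑ ^ 2 = ENNReal.ofReal (∫ x in S, ‖u x‖ ^ 2) := by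
  rw [ofReal_integral_eq_lintegral_ofReal (integrable_norm_sq u).integrableOn
    (Eventually.of_forall fun x => by positivity)]
  refine lintegral_congr fun x => ?_
  rw [ENNReal.ofReal_pow (norm_nonneg _), ofReal_norm]

theorem lintegral_enorm_bessel_sq_le (f : L2) : ∫⁻ x, ‖bessel f x‖ₑ ^ 2 ≤ ‖f‖ₑ ^ 2 := by
  have h := lintegral_enorm_sq_eq univ (bessel f)
  rw [setLIntegral_univ, setIntegral_univ, ← norm_sq_eq_integral] at h
  rw [h, ← ofReal_norm, ← ENNReal.ofReal_pow (norm_nonneg _)]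
  gcongr
  exact norm_bessel_le f

/-- A pointwise criterion for the form of `|V|` to be small. -/
theorem lintegral_mul_bessel_le_of_le {V : E3 → ℝ≥0∞} {W : E3 → ℝ≥0∞}
    {S : Set E3} (hS : MeasurableSet S) {a b : ℝ≥0∞}
    (hV : ∀ x, V x ≤ W x + S.indicator (fun _ => b) x + a) (f : L2) :
    ∫⁻ x, V x * ‖bessel f x‖ₑ ^ 2 ≤ (∫⁻ x, W x * ‖bessel f x‖ₑ ^ 2) +
      b * ENNReal.ofReal (∫ x in S, ‖bessel f x‖ ^ 2) + a * ‖f‖ₑ ^ 2 := by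
  have hm : AEMeasurable (fun x => ‖bessel f x‖ₑ ^ 2) volume :=
    (Lp.aestronglyMeasurable (bessel f)).enorm.pow_const 2
  calc ∫⁻ x, V x * ‖bessel f x‖ₑ ^ 2
      ≤ ∫⁻ x, (W x * ‖bessel f x‖ₑ ^ 2 + S.indicator (fun x => b * ‖bessel f x‖ₑ ^ 2) x
        + a * ‖bessel f x‖ₑ ^ 2) := by
        refine lintegral_mono fun x => ?_
        refine (mul_le_mul_left (hV x) _).trans (le_of_eq ?_)
        rw [add_mul, add_mul]
        congr 2
        by_cases hx : x ∈ S <;> simp [hx]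
    _ = (∫⁻ x, W x * ‖bessel f x‖ₑ ^ 2) + b * (∫⁻ x in S, ‖bessel f x‖ₑ ^ 2)
        + a * ∫⁻ x, ‖bessel f x‖ₑ ^ 2 := by
        rw [lintegral_add_right' _ (hm.const_mul a),
          lintegral_add_right' _ ((hm.const_mul b).indicator hS), lintegral_indicator hS,
          lintegral_const_mul'' _ hm.restrict, lintegral_const_mul'' _ hm]
    _ ≤ _ := by
        rw [lintegral_enorm_sq_eq]
        gcongr
        exact lintegral_enorm_bessel_sq_le f

end

section

/-! ### Coulomb potentials -/

/-- The Coulomb potential of the measure `ν`. -/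
def coulombPot (ν : Measure E3) (x : E3) : ℝ := ∫ y, 1 / ‖x - y‖ ∂ν

theorem measurable_enorm_inv_norm : Measurable fun w : E3 => ‖1 / ‖w‖‖ₑ := by fun_prop

theorem lintegral_ball_rpow_ne_top :
    ∫⁻ w in Metric.ball (0 : E3) 1, ‖1 / ‖w‖‖ₑ ^ (3 / 2 : ℝ) ≠ ∞ := by
  have h := integrableOn_ball_of_norm_le_rpow (μ := (volume : Measure E3)) (by simp)
    (f := fun w : E3 => ‖w‖ ^ (-(3 / 2) : ℝ)) (C := 1) (α := 3 / 2) (r := 1)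
    (by norm_num) (Eventually.of_forall fun w => by
      rw [one_mul, Real.norm_eq_abs, abs_of_nonneg (by positivity)])
    (measurable_norm.pow_const _).aestronglyMeasurable
  have h2 := (hasFiniteIntegral_iff_enorm.1 h.2).ne
  convert h2 using 3 with w
  rw [Real.rpow_neg (norm_nonneg _), ← Real.inv_rpow (norm_nonneg _), one_div,
    Real.enorm_rpow_of_nonneg (by positivity) (by norm_num)]

/-- Absolute continuity of the integral: `|w|^(-3/2)` is integrable near the origin of `ℝ³`, and the
balls shrink to measure zero. -/
theorem tendsto_lintegral_ball_rpow :
    Tendsto (fun n : ℕ => ∫⁻ w, (Metric.ball (0 : E3) (1 / ((n : ℝ) + 1))).indicator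
      (fun w => ‖1 / ‖w‖‖ₑ) w ^ (3 / 2 : ℝ)) atTop (𝓝 0) := by
  have hv : Tendsto (fun n : ℕ => volume (Metric.ball (0 : E3) (1 / ((n : ℝ) + 1)))) atTop
      (𝓝 0) := by
    have h1 : ∀ n : ℕ, volume (Metric.ball (0 : E3) (1 / ((n : ℝ) + 1))) =
        ENNReal.ofReal ((1 / ((n : ℝ) + 1)) ^ 3) * volume (Metric.ball (0 : E3) 1) := fun n => by
      rw [Measure.addHaar_ball _ _ (by positivity)]; simp
    simp_rw [h1]
    have h2 : Tendsto (fun n : ℕ => ENNReal.ofReal ((1 / ((n : ℝ) + 1)) ^ 3)) atTop (𝓝 0) := by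
      have := (tendsto_one_div_add_atTop_nhds_zero_nat (𝕜 := ℝ)).pow 3
      simpa using ENNReal.tendsto_ofReal this
    simpa using ENNReal.Tendsto.mul_const h2
      (Or.inr (measure_ball_lt_top (μ := volume) (x := (0 : E3)) (r := 1)).ne)
  have h3 := tendsto_setLIntegral_zero
    (f := (Metric.ball (0 : E3) 1).indicator fun w => ‖1 / ‖w‖‖ₑ ^ (3 / 2 : ℝ))
    (by rw [lintegral_indicator measurableSet_ball]; exact lintegral_ball_rpow_ne_top) hv
  refine h3.congr fun n => ?_
  rw [← lintegral_indicator measurableSet_ball]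
  refine lintegral_congr fun w => ?_
  by_cases hw : w ∈ Metric.ball (0 : E3) (1 / ((n : ℝ) + 1))
  · have : w ∈ Metric.ball (0 : E3) 1 := by
      refine Metric.ball_subset_ball ?_ hw
      rw [div_le_one (by positivity)]
      linarith [Nat.cast_nonneg (α := ℝ) n]
    rw [indicator_of_mem hw, indicator_of_mem hw, indicator_of_mem this]
  · rw [indicator_of_notMem hw, indicator_of_notMem hw, ENNReal.zero_rpow_of_pos (by norm_num)]

/-- The singular part of the Coulomb kernel is form-small, uniformly in the position. -/
theorem exists_lintegral_ball_mul_bessel_le {η : ℝ≥0∞} (hη : η ≠ 0) :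
    ∃ δ : ℝ, 0 < δ ∧ ∀ (y : E3) (f : L2),
      ∫⁻ x, (Metric.ball (0 : E3) δ).indicator (fun w => ‖1 / ‖w‖‖ₑ) (x - y) * ‖bessel f x‖ₑ ^ 2
        ≤ η * ‖f‖ₑ ^ 2 := by
  obtain ⟨C, hC⟩ := exists_lintegral_mul_bessel_le
  have h1 : Tendsto (fun n : ℕ => (C : ℝ≥0∞) * (∫⁻ w, (Metric.ball (0 : E3)
      (1 / ((n : ℝ) + 1))).indicator (fun w => ‖1 / ‖w‖‖ₑ) w ^ (3 / 2 : ℝ)) ^ (2 / 3 : ℝ))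
      atTop (𝓝 0) := by
    have := (ENNReal.continuous_rpow_const (y := (2 / 3 : ℝ))).continuousAt.tendsto.comp
      tendsto_lintegral_ball_rpow
    rw [ENNReal.zero_rpow_of_pos (by norm_num)] at this
    simpa using ENNReal.Tendsto.const_mul this (Or.inr (ENNReal.coe_ne_top (r := C)))
  obtain ⟨n, hn⟩ := (h1.eventually (gt_mem_nhds (pos_iff_ne_zero.2 hη))).exists
  refine ⟨1 / ((n : ℝ) + 1), by positivity, fun y f => ?_⟩
  set F := (Metric.ball (0 : E3) (1 / ((n : ℝ) + 1))).indicator (fun w => ‖1 / ‖w‖‖ₑ) with hF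
  have hFm : Measurable F := measurable_enorm_inv_norm.indicator measurableSet_ball
  refine (hC (fun x => F (x - y)) (hFm.comp (measurable_sub_const y)).aemeasurable f).trans ?_
  -- Translation invariance removes `y`, so a single radius serves all positions.
  rw [lintegral_sub_right_eq_self (fun w => F w ^ (3 / 2 : ℝ)) y]
  gcongr

theorem enorm_inv_norm_le {δ : ℝ} (hδ : 0 < δ) {w : E3} (hw : δ ≤ ‖w‖) :
    ‖1 / ‖w‖‖ₑ ≤ ENNReal.ofReal (1 / δ) := by
  rw [← ofReal_norm, Real.norm_eq_abs, abs_of_nonneg (by positivity)]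
  gcongr

/-- Three zones: a small ball around the singularity, a bounded region where the kernel is at most
`1 / δ`, and the far field, where `‖x - y‖ ≥ ‖x‖ - ‖y‖ ≥ R`. -/
theorem enorm_inv_norm_sub_le {δ R R' : ℝ} (hδ : 0 < δ) (hR : 0 < R) {y : E3} (hy : ‖y‖ ≤ R')
    (x : E3) : ‖1 / ‖x - y‖‖ₑ ≤
      (Metric.ball (0 : E3) δ).indicator (fun w => ‖1 / ‖w‖‖ₑ) (x - y) +
      (Metric.ball (0 : E3) (R + R')).indicator (fun _ => ENNReal.ofReal (1 / δ)) x +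
      ENNReal.ofReal (1 / R) := by
  by_cases h1 : x - y ∈ Metric.ball (0 : E3) δ
  · rw [indicator_of_mem h1, add_assoc]; exact le_self_add
  · have h1' : δ ≤ ‖x - y‖ := by simpa using h1
    by_cases h2 : x ∈ Metric.ball (0 : E3) (R + R')
    · rw [indicator_of_notMem h1, indicator_of_mem h2, zero_add]
      exact (enorm_inv_norm_le hδ h1').trans le_self_add
    · have h2' : R + R' ≤ ‖x‖ := by simpa using h2
      refine (enorm_inv_norm_le hR ?_).trans le_add_self
      have := norm_sub_norm_le x y
      linarith

/-- A cruder variant needing no bound on `y`. The empty middle zone gives it the shape required by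
`lintegral_mul_bessel_le_of_le`. -/
theorem enorm_inv_norm_sub_le' {δ : ℝ} (hδ : 0 < δ) (y x : E3) : ‖1 / ‖x - y‖‖ₑ ≤
      (Metric.ball (0 : E3) δ).indicator (fun w => ‖1 / ‖w‖‖ₑ) (x - y) +
      (∅ : Set E3).indicator (fun _ => 0) x + ENNReal.ofReal (1 / δ) := by
  by_cases h1 : x - y ∈ Metric.ball (0 : E3) δ
  · rw [indicator_of_mem h1, add_assoc]; exact le_self_add
  · have h1' : δ ≤ ‖x - y‖ := by simpa using h1
    exact (enorm_inv_norm_le hδ h1').trans le_add_self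

theorem exists_lintegral_kernel_le : ∃ C : ℝ, 0 ≤ C ∧ ∀ (y : E3) (f : L2),
    ∫⁻ x, ‖1 / ‖x - y‖‖ₑ * ‖bessel f x‖ₑ ^ 2 ≤ ENNReal.ofReal (C * ‖f‖ ^ 2) := by
  obtain ⟨δ, hδ, h⟩ := exists_lintegral_ball_mul_bessel_le (η := 1) one_ne_zero
  refine ⟨1 + 1 / δ, by positivity, fun y f => ?_⟩
  have hf : ‖f‖ₑ ^ 2 = ENNReal.ofReal (‖f‖ ^ 2) := by
    rw [ENNReal.ofReal_pow (norm_nonneg _), ofReal_norm]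
  refine (lintegral_mul_bessel_le_of_le MeasurableSet.empty
    (enorm_inv_norm_sub_le' hδ y) f).trans ?_
  refine (add_le_add (add_le_add (h y f) le_rfl) le_rfl).trans ?_
  rw [zero_mul, add_zero, one_mul, hf, ← ENNReal.ofReal_mul (by positivity),
    ← ENNReal.ofReal_add (by positivity) (by positivity)]
  exact ENNReal.ofReal_le_ofReal (le_of_eq (by ring))

theorem lintegral_lintegral_kernel (ν : Measure E3) [IsFiniteMeasure ν] (f : L2) :
    ∫⁻ x, (∫⁻ y, ‖1 / ‖x - y‖‖ₑ ∂ν) * ‖bessel f x‖ₑ ^ 2 =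
      ∫⁻ y, ∫⁻ x, ‖1 / ‖x - y‖‖ₑ * ‖bessel f x‖ₑ ^ 2 ∂volume ∂ν := by
  have h : Measurable (Function.uncurry fun (x y : E3) => ‖1 / ‖x - y‖‖ₑ * ‖bessel f x‖ₑ ^ 2) := by
    refine (measurable_enorm_inv_norm.comp (measurable_fst.sub measurable_snd)).mul ?_
    exact (((Lp.stronglyMeasurable (bessel f)).measurable.comp measurable_fst).enorm).pow_const 2
  rw [← lintegral_lintegral_swap h.aemeasurable]
  refine lintegral_congr fun x => ?_
  rw [lintegral_mul_const]
  exact measurable_enorm_inv_norm.comp (measurable_const.sub measurable_id)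

theorem aestronglyMeasurable_coulombPot (ν : Measure E3) [IsFiniteMeasure ν] :
    AEStronglyMeasurable (coulombPot ν) volume := by
  have h : StronglyMeasurable (Function.uncurry fun (x y : E3) => 1 / ‖x - y‖) :=
    Measurable.stronglyMeasurable (by unfold Function.uncurry; fun_prop)
  exact h.integral_prod_right.aestronglyMeasurable

theorem lintegral_coulombPot_le (ν : Measure E3) [IsFiniteMeasure ν] (f : L2) :
    ∫⁻ x, ‖coulombPot ν x‖ₑ * ‖bessel f x‖ₑ ^ 2 ≤
      ∫⁻ y, ∫⁻ x, ‖1 / ‖x - y‖‖ₑ * ‖bessel f x‖ₑ ^ 2 ∂volume ∂ν := by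
  rw [← lintegral_lintegral_kernel]
  refine lintegral_mono fun x => ?_
  gcongr
  exact enorm_integral_le_lintegral_enorm _

theorem exists_measure_compl_closedBall_le (ν : Measure E3) [IsFiniteMeasure ν] {η : ℝ≥0∞}
    (hη : η ≠ 0) : ∃ R : ℝ, 0 ≤ R ∧ ν (Metric.closedBall 0 R)ᶜ ≤ η := by
  have h : Tendsto (fun n : ℕ => ν (Metric.closedBall (0 : E3) n)ᶜ) atTop (𝓝 0) := by
    have h1 := tendsto_measure_iInter_atTop (μ := ν)
      (s := fun n : ℕ => (Metric.closedBall (0 : E3) n)ᶜ)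
      (fun n => measurableSet_closedBall.compl.nullMeasurableSet)
      (fun m n hmn => compl_subset_compl.2
        (Metric.closedBall_subset_closedBall (by exact_mod_cast hmn)))
      ⟨0, measure_ne_top _ _⟩
    rwa [← compl_iUnion, Metric.iUnion_closedBall_nat, compl_univ, measure_empty] at h1
  obtain ⟨n, hn⟩ := (h.eventually (gt_mem_nhds (pos_iff_ne_zero.2 hη))).exists
  exact ⟨n, n.cast_nonneg, hn.le⟩

/-- By Tonelli it suffices to bound the form of each kernel `1 / |x - y|` and integrate in `y`. The
measure need not have bounded support: charges within `R'` are treated by the three zones, and the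
small remaining charge by the bound uniform in `y`. -/
theorem isFormSmall_coulombPot (ν : Measure E3) [IsFiniteMeasure ν] :
    IsFormSmall (coulombPot ν) := by
  refine ⟨aestronglyMeasurable_coulombPot ν, fun ε hε => ?_⟩
  obtain ⟨C, hC, far⟩ := exists_lintegral_kernel_le
  set m : ℝ := ν.real univ
  have hm : 0 ≤ m := measureReal_nonneg
  have hmν : ν univ = ENNReal.ofReal m := by simp [m]
  -- The singular part and the far field `1 / R` each contribute `ε / (4 (m + 1))`, hence at most `ε
  -- / 2` after integrating over the charge `m`. The tail of `ν` contributes the other `ε / 2`.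
  obtain ⟨δ, hδ, h⟩ := exists_lintegral_ball_mul_bessel_le (η := ENNReal.ofReal (ε / (4 * (m + 1))))
    (by simpa using by positivity)
  set R : ℝ := 4 * (m + 1) / ε with hR
  have hR0 : 0 < R := by positivity
  obtain ⟨R', hR'0, hR'⟩ := exists_measure_compl_closedBall_le ν
    (η := ENNReal.ofReal (ε / (2 * (C + 1)))) (by simpa using by positivity)
  refine ⟨Metric.ball 0 (R + R'), measure_ball_lt_top.ne, m / δ, by positivity, fun f => ?_⟩
  refine (lintegral_coulombPot_le ν f).trans ?_
  set I := ∫ x in Metric.ball 0 (R + R'), ‖bessel f x‖ ^ 2 with hI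
  have hI0 : 0 ≤ I := setIntegral_norm_sq_nonneg _ _
  have hf : ‖f‖ₑ ^ 2 = ENNReal.ofReal (‖f‖ ^ 2) := by
    rw [ENNReal.ofReal_pow (norm_nonneg _), ofReal_norm]
  have near : ∀ y ∈ Metric.closedBall (0 : E3) R',
      ∫⁻ x, ‖1 / ‖x - y‖‖ₑ * ‖bessel f x‖ₑ ^ 2 ≤
        ENNReal.ofReal (ε / (2 * (m + 1)) * ‖f‖ ^ 2 + 1 / δ * I) := fun y hy => by
    refine (lintegral_mul_bessel_le_of_le measurableSet_ball
      (enorm_inv_norm_sub_le hδ hR0 (by simpa using hy)) f).trans ?_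
    refine (add_le_add (add_le_add (h y f) le_rfl) le_rfl).trans ?_
    rw [hf, ← ENNReal.ofReal_mul (by positivity), ← ENNReal.ofReal_mul (by positivity),
      ← ENNReal.ofReal_mul (by positivity), ← ENNReal.ofReal_add (by positivity) (by positivity),
      ← ENNReal.ofReal_add (by positivity) (by positivity)]
    refine ENNReal.ofReal_le_ofReal (le_of_eq ?_)
    have e : 1 / R = ε / (4 * (m + 1)) := by rw [hR, one_div_div]
    rw [e]; field_simp; ring
  rw [← lintegral_add_compl _ (measurableSet_closedBall (x := (0 : E3)) (ε := R'))]
  refine (add_le_add (setLIntegral_mono measurable_const near)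
    (setLIntegral_mono measurable_const fun y _ => far y f)).trans ?_
  rw [setLIntegral_const, setLIntegral_const]
  refine (add_le_add (mul_le_mul_right ((measure_mono (subset_univ _)).trans hmν.le) _)
    (mul_le_mul_right hR' _)).trans ?_
  rw [← ENNReal.ofReal_mul (by positivity), ← ENNReal.ofReal_mul (by positivity),
    ← ENNReal.ofReal_add (by positivity) (by positivity)]
  refine ENNReal.ofReal_le_ofReal ?_
  have e1 : C * ‖f‖ ^ 2 * (ε / (2 * (C + 1))) ≤ ε / 2 * ‖f‖ ^ 2 := by
    rw [mul_div_assoc', div_le_iff₀ (by positivity)]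
    nlinarith [mul_nonneg hε.le (sq_nonneg ‖f‖)]
  have e2 : ε / (2 * (m + 1)) * m ≤ ε / 2 := by
    rw [div_mul_eq_mul_div, div_le_div_iff₀ (by positivity) (by positivity)]
    nlinarith
  have e3 : ε / (2 * (m + 1)) * m * ‖f‖ ^ 2 ≤ ε / 2 * ‖f‖ ^ 2 := by gcongr
  have e4 : (ε / (2 * (m + 1)) * ‖f‖ ^ 2 + 1 / δ * I) * m =
      ε / (2 * (m + 1)) * m * ‖f‖ ^ 2 + m / δ * I := by ring
  rw [e4]
  linarith

end

section

/-! ### The exchange-correlation potential -/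

theorem AdmissibleXC.continuousOn_vxc {exc : ℝ → ℝ} (hexc : AdmissibleXC exc) :
    ContinuousOn (vxc exc) (Ici 0) :=
  hexc.contDiffOn.continuousOn_derivWithin (uniqueDiffOn_Ici 0) le_rfl

theorem AdmissibleXC.measurable_vxc_comp {exc : ℝ → ℝ} (hexc : AdmissibleXC exc) {ρ : E3 → ℝ}
    (hρ : Measurable ρ) (hρ0 : ∀ x, 0 ≤ ρ x) : Measurable fun x => vxc exc (ρ x) := by
  have h : Continuous fun t : ℝ => vxc exc (max t 0) :=
    hexc.continuousOn_vxc.comp_continuous (by fun_prop) fun t => le_max_right t 0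
  have e : (fun x => vxc exc (ρ x)) = (fun t : ℝ => vxc exc (max t 0)) ∘ ρ := by
    ext x; simp [hρ0 x]
  rw [e]; exact h.measurable.comp hρ

theorem AdmissibleXC.exists_abs_vxc_le {exc : ℝ → ℝ} (hexc : AdmissibleXC exc) {ε : ℝ}
    (hε : 0 < ε) : ∃ δ : ℝ, 0 < δ ∧ ∀ t, 0 ≤ t → t ≤ δ → |vxc exc t| ≤ ε := by
  have h := hexc.continuousOn_vxc 0 self_mem_Ici
  obtain ⟨δ, hδ, h⟩ := Metric.continuousWithinAt_iff.1 h ε hε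
  refine ⟨δ / 2, by positivity, fun t h0 ht => ?_⟩
  have := h (x := t) h0 (by rw [Real.dist_eq, sub_zero, abs_of_nonneg h0]; linarith)
  rw [hexc.vxc_zero, Real.dist_eq, sub_zero] at this
  exact this.le

/-- Here `p - 1 < 2 / 3`, and `t ^ (2 / 3)` is exactly the power whose `L^(3/2)` norm is controlled
by the `L¹` norm of the density. -/
theorem AdmissibleXC.exists_abs_vxc_le_rpow {exc : ℝ → ℝ} (hexc : AdmissibleXC exc) :
    ∃ c : ℝ, 0 < c ∧ (∀ t, 1 ≤ t → |vxc exc t| ≤ c * t ^ (2 / 3 : ℝ)) ∧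
      ∀ M, 1 ≤ M → ∀ t, 0 ≤ t → t ≤ M → |vxc exc t| ≤ c * M := by
  obtain ⟨p, hp1, hp, c, hc, h⟩ := hexc.growth
  refine ⟨2 * c, by positivity, fun t ht => (h t (by linarith)).trans ?_,
    fun M hM t ht htM => (h t ht).trans ?_⟩
  · have h1 : t ^ (p - 1) ≤ t ^ (2 / 3 : ℝ) := Real.rpow_le_rpow_of_exponent_le ht (by linarith)
    have h2 : 1 ≤ t ^ (2 / 3 : ℝ) := Real.one_le_rpow ht (by norm_num)
    nlinarith
  · have h1 : t ^ (p - 1) ≤ M ^ (p - 1) := Real.rpow_le_rpow ht htM (by linarith)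
    have h2 : M ^ (p - 1) ≤ M ^ (1 : ℝ) := Real.rpow_le_rpow_of_exponent_le hM (by linarith)
    rw [Real.rpow_one] at h2
    nlinarith

/-- Markov's inequality makes the superlevel sets shrink in measure; absolute continuity of the
integral does the rest. -/
theorem tendsto_setLIntegral_gt {ρ : E3 → ℝ} (hρi : Integrable ρ volume) :
    Tendsto (fun n : ℕ => ∫⁻ x in {x | (n : ℝ) + 1 < ρ x}, ‖ρ x‖ₑ) atTop (𝓝 0) := by
  have h1 : ∫⁻ x, ‖ρ x‖ₑ ≠ ∞ := (hasFiniteIntegral_iff_enorm.1 hρi.2).ne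
  refine tendsto_setLIntegral_zero h1 ?_
  have h2 : ∀ n : ℕ, volume {x | (n : ℝ) + 1 < ρ x} ≤ (∫⁻ x, ‖ρ x‖ₑ) / ((n + 1 : ℕ) : ℝ≥0∞) :=
    fun n => by
    refine le_trans (measure_mono fun x (hx : (n : ℝ) + 1 < ρ x) => ?_)
      (meas_ge_le_lintegral_div hρi.aestronglyMeasurable.enorm (by simp) (by simp))
    rw [mem_ofPred_eq, ← ofReal_norm, ← ENNReal.ofReal_natCast]
    refine ENNReal.ofReal_le_ofReal ?_
    push_cast
    exact hx.le.trans (le_abs_self _)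
  refine tendsto_of_tendsto_of_tendsto_of_le_of_le tendsto_const_nhds ?_
    (fun n => zero_le) h2
  have h3 := ENNReal.Tendsto.const_div (a := ∫⁻ x, ‖ρ x‖ₑ)
    (ENNReal.tendsto_nat_nhds_top.comp (tendsto_add_atTop_nat 1)) (Or.inr h1)
  simpa using h3

/-- Split by the size of `ρ`. Where it is below `δ`, continuity and `v_xc(0) = 0` make the potential
small; at intermediate values it is bounded on a set of finite measure; above `n + 1` it is at most
`c ρ^(2/3)`, which is small in `L^(3/2)`. -/
theorem isFormSmall_vxc {exc : ℝ → ℝ} (hexc : AdmissibleXC exc) {ρ : E3 → ℝ} (hρ : Measurable ρ)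
    (hρ0 : ∀ x, 0 ≤ ρ x) (hρi : Integrable ρ volume) :
    IsFormSmall (fun x => vxc exc (ρ x)) := by
  refine ⟨(hexc.measurable_vxc_comp hρ hρ0).aestronglyMeasurable, fun ε hε => ?_⟩
  obtain ⟨δ, hδ, hδ'⟩ := hexc.exists_abs_vxc_le (ε := ε / 2) (by positivity)
  obtain ⟨c, hc, hc1, hc2⟩ := hexc.exists_abs_vxc_le_rpow
  obtain ⟨C, hC⟩ := exists_lintegral_mul_bessel_le
  have hlim : Tendsto (fun n : ℕ => (C : ℝ≥0∞) * (ENNReal.ofReal c ^ (3 / 2 : ℝ) *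
      ∫⁻ x in {x | (n : ℝ) + 1 < ρ x}, ‖ρ x‖ₑ) ^ (2 / 3 : ℝ)) atTop (𝓝 0) := by
    have h1 := ENNReal.Tendsto.const_mul (a := ENNReal.ofReal c ^ (3 / 2 : ℝ))
      (tendsto_setLIntegral_gt hρi)
      (Or.inr (ENNReal.rpow_ne_top_of_nonneg (by norm_num) ENNReal.ofReal_ne_top))
    rw [mul_zero] at h1
    have h2 := (ENNReal.continuous_rpow_const (y := (2 / 3 : ℝ))).continuousAt.tendsto.comp h1
    rw [ENNReal.zero_rpow_of_pos (by norm_num)] at h2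
    simpa using ENNReal.Tendsto.const_mul h2 (Or.inr (ENNReal.coe_ne_top (r := C)))
  obtain ⟨n, hn⟩ := (hlim.eventually (gt_mem_nhds
    (ENNReal.ofReal_pos.2 (show 0 < ε / 2 by positivity)))).exists
  set T : Set E3 := {x | (n : ℝ) + 1 < ρ x} with hTdef
  have hT : MeasurableSet T := measurableSet_lt measurable_const hρ
  set S : Set E3 := {x | δ ≤ ρ x} with hSdef
  have hS : MeasurableSet S := measurableSet_le measurable_const hρ
  have hSfin : volume S ≠ ∞ := (hρi.measure_ge_lt_top hδ).ne
  set W : E3 → ℝ≥0∞ := T.indicator fun x => ENNReal.ofReal c * ‖ρ x‖ₑ ^ (2 / 3 : ℝ) with hWdef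
  have hW : Measurable W :=
    ((hρ.enorm.pow_const _).const_mul _).indicator hT
  refine ⟨S, hSfin, c * (n + 1), by positivity, fun f => ?_⟩
  have hpt : ∀ x, ‖vxc exc (ρ x)‖ₑ ≤ W x +
      S.indicator (fun _ => ENNReal.ofReal (c * (n + 1))) x + ENNReal.ofReal (ε / 2) := fun x => by
    by_cases h1 : x ∈ T
    · have h1' : (n : ℝ) + 1 < ρ x := h1
      rw [hWdef, indicator_of_mem h1, add_assoc]
      refine le_trans ?_ le_self_add
      rw [← ofReal_norm (ρ x), ENNReal.ofReal_rpow_of_nonneg (norm_nonneg _) (by norm_num),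
        ← ENNReal.ofReal_mul hc.le, ← ofReal_norm, Real.norm_eq_abs, Real.norm_eq_abs,
        abs_of_nonneg (hρ0 x)]
      exact ENNReal.ofReal_le_ofReal (hc1 _ (by linarith [Nat.cast_nonneg (α := ℝ) n]))
    · have h1' : ρ x ≤ (n : ℝ) + 1 := not_lt.1 h1
      rw [← ofReal_norm, Real.norm_eq_abs]
      by_cases h2 : x ∈ S
      · rw [indicator_of_mem h2]
        refine (ENNReal.ofReal_le_ofReal (hc2 _ ?_ _ (hρ0 x) h1')).trans ?_
        · linarith [Nat.cast_nonneg (α := ℝ) n]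
        · exact le_add_self.trans le_self_add
      · have h2' : ρ x < δ := not_le.1 h2
        exact (ENNReal.ofReal_le_ofReal (hδ' _ (hρ0 x) h2'.le)).trans le_add_self
  refine (lintegral_mul_bessel_le_of_le hS hpt f).trans ?_
  have hWint : ∫⁻ x, W x ^ (3 / 2 : ℝ) =
      ENNReal.ofReal c ^ (3 / 2 : ℝ) * ∫⁻ x in T, ‖ρ x‖ₑ := by
    rw [← lintegral_const_mul _ hρ.enorm, ← lintegral_indicator hT]
    refine lintegral_congr fun x => ?_
    by_cases h1 : x ∈ T
    · rw [hWdef, indicator_of_mem h1, indicator_of_mem h1,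
        ENNReal.mul_rpow_of_nonneg _ _ (by norm_num), ← ENNReal.rpow_mul]
      norm_num
    · rw [hWdef, indicator_of_notMem h1, indicator_of_notMem h1,
        ENNReal.zero_rpow_of_pos (by norm_num)]
  have h1 := hC W hW.aemeasurable f
  rw [hWint] at h1
  have h2 := h1.trans (mul_le_mul_left hn.le _)
  refine (add_le_add (add_le_add h2 le_rfl) le_rfl).trans ?_
  have hI0 := setIntegral_norm_sq_nonneg S (bessel f)
  have hf : ‖f‖ₑ ^ 2 = ENNReal.ofReal (‖f‖ ^ 2) := by
    rw [ENNReal.ofReal_pow (norm_nonneg _), ofReal_norm]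
  rw [hf, ← ENNReal.ofReal_mul (by positivity), ← ENNReal.ofReal_mul (by positivity),
    ← ENNReal.ofReal_add (by positivity) (by positivity),
    ← ENNReal.ofReal_add (by positivity) (by positivity)]
  refine ENNReal.ofReal_le_ofReal (le_of_eq (by ring))

/-! ### The electron density and the total potential -/

variable {n : ℕ}

theorem measurable_density (Φ : Fin n → L2) : Measurable (density Φ) :=
  (Finset.measurable_sum _ fun k _ =>
    ((Lp.stronglyMeasurable (Φ k)).measurable.norm.pow_const 2)).const_mul 2

theorem density_nonneg (Φ : Fin n → L2) (x : E3) : 0 ≤ density Φ x :=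
  mul_nonneg two_pos.le (Finset.sum_nonneg fun k _ => by positivity)

theorem integrable_density (Φ : Fin n → L2) : Integrable (density Φ) volume :=
  (integrable_finsetSum _ fun k _ => integrable_norm_sq (Φ k)).const_mul 2

theorem integral_density {Φ : Fin n → L2} (hΦ : Φ ∈ orbitalSet n) :
    ∫ x, density Φ x = 2 * n := by
  unfold density
  rw [integral_const_mul, integral_finsetSum _ fun k _ => integrable_norm_sq (Φ k)]
  simp_rw [← norm_sq_eq_integral, hΦ.2.1]
  simp

/-- The measure with the electron density as density. -/
def densityMeasure (Φ : Fin n → L2) : Measure E3 :=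
  volume.withDensity fun x => ENNReal.ofReal (density Φ x)

theorem densityMeasure_univ (Φ : Fin n → L2) :
    densityMeasure Φ univ = ENNReal.ofReal (∫ x, density Φ x) := by
  rw [densityMeasure, withDensity_apply _ MeasurableSet.univ, setLIntegral_univ,
    ofReal_integral_eq_lintegral_ofReal (integrable_density Φ)
      (Eventually.of_forall (density_nonneg Φ))]

instance (Φ : Fin n → L2) : IsFiniteMeasure (densityMeasure Φ) :=
  ⟨by rw [densityMeasure_univ]; exact ENNReal.ofReal_lt_top⟩

/-- Puts the Hartree potential on the same footing as the nuclear one, so that every Coulomb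
estimate covers both. -/
theorem vHartree_density (Φ : Fin n → L2) :
    vHartree (density Φ) = coulombPot (densityMeasure Φ) := by
  ext x
  rw [vHartree, coulombPot, densityMeasure, integral_withDensity_eq_integral_toReal_smul
    (measurable_density Φ).ennreal_ofReal (Eventually.of_forall fun x => ENNReal.ofReal_lt_top)]
  refine integral_congr_ae (Eventually.of_forall fun y => ?_)
  simp only [ENNReal.toReal_ofReal (density_nonneg Φ y), smul_eq_mul]
  ring

theorem vext_eq (μ : Measure E3) : vext μ = fun x => -coulombPot μ x := rfl

/-- The total potential `v_ext + v_H + v_xc(ρ)`. -/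
def totalPot (exc : ℝ → ℝ) (μ : Measure E3) (ρ : E3 → ℝ) (x : E3) : ℝ :=
  vext μ x + vHartree ρ x + vxc exc (ρ x)

theorem isFormSmall_totalPot {exc : ℝ → ℝ} (hexc : AdmissibleXC exc) (μ : Measure E3)
    [IsFiniteMeasure μ] (Φ : Fin n → L2) : IsFormSmall (totalPot exc μ (density Φ)) := by
  have h1 : IsFormSmall (vext μ) := vext_eq μ ▸ (isFormSmall_coulombPot μ).neg
  have h2 : IsFormSmall (vHartree (density Φ)) :=
    vHartree_density Φ ▸ isFormSmall_coulombPot (densityMeasure Φ)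
  exact (h1.add h2).add (isFormSmall_vxc hexc (measurable_density Φ) (density_nonneg Φ)
    (integrable_density Φ))

theorem excitationEnergy_bessel (exc : ℝ → ℝ) (μ : Measure E3) (ρ : E3 → ℝ) (f : L2) :
    excitationEnergy exc μ ρ (bessel f) =
      2 * π ^ 2 * (‖f‖ ^ 2 - ‖bessel f‖ ^ 2) + potForm (totalPot exc μ ρ) f := by
  rw [excitationEnergy, integral_sum_weakPartial_bessel]
  have : potForm (totalPot exc μ ρ) f =
    ∫ x, (vext μ x + vHartree ρ x + vxc exc (ρ x)) * ‖bessel f x‖ ^ 2 := rfl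
  rw [this]
  ring

end

section

/-! ### The energy as a quadratic form -/

/-- The energy of `bessel f` in the potential `V`. -/
def energyForm (V : E3 → ℝ) (f : L2) : ℝ :=
  2 * π ^ 2 * (‖f‖ ^ 2 - ‖bessel f‖ ^ 2) + potForm V f

theorem potForm_smul (V : E3 → ℝ) (c : ℂ) (f : L2) :
    potForm V (c • f) = ‖c‖ ^ 2 * potForm V f := by
  rw [potForm, potForm, ← integral_const_mul, map_smul]
  refine integral_congr_ae ?_
  filter_upwards [Lp.coeFn_smul c (bessel f)] with x hx
  rw [hx, Pi.smul_apply, norm_smul]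
  ring

theorem energyForm_smul (V : E3 → ℝ) (c : ℂ) (f : L2) :
    energyForm V (c • f) = ‖c‖ ^ 2 * energyForm V f := by
  rw [energyForm, energyForm, potForm_smul, map_smul, norm_smul, norm_smul]
  ring

/-- The bounds `r`, `s` are kept separate from the norms so that the terms in `f` and in `bessel f`
get the same right-hand side. -/
theorem abs_norm_add_sq_sub_le {E : Type*} [NormedAddCommGroup E] (a b : E) {r s : ℝ}
    (ha : ‖a‖ ≤ r) (hb : ‖b‖ ≤ s) : |‖a + b‖ ^ 2 - ‖a‖ ^ 2| ≤ s * (1 + r ^ 2) + s ^ 2 := by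
  have h1 := norm_add_le a b
  have h2 := norm_sub_norm_le a (-b)
  rw [norm_neg, sub_neg_eq_add] at h2
  have h5 := norm_nonneg a
  have h6 := norm_nonneg b
  have h7 := norm_nonneg (a + b)
  have key : |‖a + b‖ ^ 2 - ‖a‖ ^ 2| ≤ ‖b‖ * (2 * ‖a‖ + ‖b‖) := by
    have e : ‖a + b‖ ^ 2 - ‖a‖ ^ 2 = (‖a + b‖ - ‖a‖) * (‖a + b‖ + ‖a‖) := by ring
    rw [e, abs_mul, abs_of_nonneg (by positivity : 0 ≤ ‖a + b‖ + ‖a‖)]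
    refine mul_le_mul (abs_le.2 ⟨by linarith, by linarith⟩) (by linarith) (by positivity) h6
  refine key.trans ?_
  have h8 : ‖b‖ * (2 * ‖a‖ + ‖b‖) ≤ s * (2 * r + s) := by gcongr; exact h6.trans hb
  have h9 : s * (2 * r) ≤ s * (1 + r ^ 2) :=
    mul_le_mul_of_nonneg_left (by nlinarith [sq_nonneg (r - 1)]) (h6.trans hb)
  nlinarith

/-- Local Lipschitz bound in the `H¹` norm. It gives continuity of the energy and measures the cost
of orthogonalising a trial function. -/
theorem IsFormSmall.exists_abs_energyForm_add_sub_le {V : E3 → ℝ} (hV : IsFormSmall V) :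
    ∃ C : ℝ, 0 ≤ C ∧ ∀ f g : L2,
      |energyForm V (f + g) - energyForm V f| ≤ C * (‖g‖ * (1 + ‖f‖ ^ 2) + ‖g‖ ^ 2) := by
  obtain ⟨C, hC, h⟩ := hV.exists_potForm_abs_le_norm_sq
  refine ⟨4 * π ^ 2 + C, by positivity, fun f g => ?_⟩
  rcases eq_or_ne g 0 with rfl | hg
  · simp
  have hg' : 0 < ‖g‖ := norm_pos_iff.2 hg
  -- With `δ = ‖g‖` the singular factor `δ⁻¹ ‖g‖²` becomes `‖g‖`.
  have h1 := hV.abs_potForm_add_sub_le f g hg'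
  have h2 : |potForm V (f + g) - potForm V f| ≤ C * (‖g‖ * (1 + ‖f‖ ^ 2) + ‖g‖ ^ 2) := by
    refine h1.trans ((add_le_add (mul_le_mul_of_nonneg_left (h f) hg'.le)
      (mul_le_mul_of_nonneg_left (h g) (by positivity))).trans (le_of_eq ?_))
    field_simp
    ring
  have h3 := abs_norm_add_sq_sub_le f g le_rfl le_rfl
  have h4 := abs_norm_add_sq_sub_le (bessel f) (bessel g) (norm_bessel_le f) (norm_bessel_le g)
  rw [← map_add] at h4
  rw [abs_le] at h2 h3 h4 ⊢
  unfold energyForm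
  have hp : 0 < 2 * π ^ 2 := by positivity
  constructor
  · nlinarith [mul_le_mul_of_nonneg_left h3.1 hp.le, mul_le_mul_of_nonneg_left h4.2 hp.le]
  · nlinarith [mul_le_mul_of_nonneg_left h3.2 hp.le, mul_le_mul_of_nonneg_left h4.1 hp.le]

theorem IsFormSmall.continuous_energyForm {V : E3 → ℝ} (hV : IsFormSmall V) :
    Continuous (energyForm V) := by
  obtain ⟨C, hC, h⟩ := hV.exists_abs_energyForm_add_sub_le
  rw [continuous_iff_continuousAt]
  intro f
  rw [ContinuousAt, tendsto_iff_dist_tendsto_zero]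
  have h1 : Continuous fun f' : L2 => C * (‖f' - f‖ * (1 + ‖f‖ ^ 2) + ‖f' - f‖ ^ 2) := by fun_prop
  have h2 := h1.tendsto f
  simp only [sub_self, norm_zero, zero_mul, ne_eq, OfNat.ofNat_ne_zero, not_false_eq_true,
    zero_pow, add_zero, mul_zero] at h2
  refine squeeze_zero (fun _ => dist_nonneg) (fun f' => ?_) h2
  have := h f (f' - f)
  rwa [add_sub_cancel, ← Real.dist_eq] at this

theorem excitationEnergy_eq_energyForm (exc : ℝ → ℝ) (μ : Measure E3) (ρ : E3 → ℝ) (f : L2) :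
    excitationEnergy exc μ ρ (bessel f) = energyForm (totalPot exc μ ρ) f :=
  excitationEnergy_bessel exc μ ρ f

/-! ### Existence of a HOMO -/

variable {n : ℕ}

/-- Pulled back to coefficient vectors in `ℂⁿ`, the constraint set is closed and bounded by
orthonormality, hence compact, and the energy is continuous there. -/
theorem exists_isMaxOn_homoSet (hn : 1 ≤ n) {Φ : Fin n → L2} (hΦ : Φ ∈ orbitalSet n)
    {E : L2 → ℝ} {V : E3 → ℝ} (hV : IsFormSmall V) (hE : ∀ f, E (bessel f) = energyForm V f) :
    ∃ φ ∈ homoSet Φ, IsMaxOn E (homoSet Φ) φ := by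
  choose f hf using fun k => mem_H1_iff.1 (hΦ.1 k)
  let F : (Fin n → ℂ) → L2 := fun c => ∑ k, c k • f k
  have hF : Continuous F := by fun_prop
  have hbF : ∀ c, bessel (F c) = ∑ k, c k • Φ k := fun c => by simp [F, map_sum, hf]
  let K : Set (Fin n → ℂ) := {c | ‖bessel (F c)‖ = 1}
  have hKc : IsClosed K := isClosed_eq (bessel.continuous.comp hF).norm continuous_const
  have hKb : Bornology.IsBounded K := by
    refine (Metric.isBounded_closedBall (x := (0 : Fin n → ℂ)) (r := 1)).subset fun c hc => ?_
    rw [mem_closedBall_zero_iff, pi_norm_le_iff_of_nonneg zero_le_one]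
    intro k
    have h1 : inner ℂ (Φ k) (bessel (F c)) = c k := by
      rw [hbF, hΦ.2.inner_right_fintype]
    rw [← h1]
    refine (norm_inner_le_norm _ _).trans ?_
    rw [hΦ.2.1 k, one_mul]
    exact (show ‖bessel (F c)‖ = 1 from hc).le
  have hK : IsCompact K := Metric.isCompact_of_isClosed_isBounded hKc hKb
  have hne : K.Nonempty := by
    refine ⟨Pi.single ⟨0, hn⟩ 1, ?_⟩
    change ‖bessel (F _)‖ = 1
    rw [hbF, Finset.sum_eq_single ⟨0, hn⟩]
    · rw [Pi.single_eq_same, one_smul]; exact hΦ.2.1 _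
    · intro b _ hb; rw [Pi.single_eq_of_ne hb, zero_smul]
    · simp
  obtain ⟨c, hc, hmax⟩ := hK.exists_isMaxOn hne (hV.continuous_energyForm.comp hF).continuousOn
  refine ⟨bessel (F c), ⟨?_, hc⟩, ?_⟩
  · rw [hbF]
    exact Submodule.sum_mem _ fun k _ => Submodule.smul_mem _ _ (Submodule.subset_span ⟨k, rfl⟩)
  · rintro χ ⟨hχ, hχ1⟩
    obtain ⟨d, rfl⟩ := (Submodule.mem_span_range_iff_exists_fun ℂ).1 hχ
    rw [← hbF] at hχ1 ⊢
    rw [mem_ofPred_eq, hE, hE]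
    exact hmax hχ1

/-! ### Existence of a LUMO -/

/-- Bounded sequences in `L²(ℝ³)` have weakly convergent subsequences. -/
theorem exists_subseq_weakly_tendsto {f : ℕ → L2} {B : ℝ} (hB : ∀ k, ‖f k‖ ≤ B) :
    ∃ (f₀ : L2) (φ : ℕ → ℕ), StrictMono φ ∧
      ∀ g : L2, Tendsto (fun k => inner ℂ g (f (φ k))) atTop (𝓝 (inner ℂ g f₀)) := by
  have : Fact ((2 : ℝ≥0∞) ≠ ∞) := ⟨ENNReal.ofNat_ne_top⟩
  have hsep : TopologicalSpace.SeparableSpace L2 := inferInstance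
  -- Sequential Banach–Alaoglu in the dual of a separable space, transported by the Riesz
  -- isomorphism. That map is conjugate-linear, hence the conjugation at the end.
  have hc := WeakDual.isSeqCompact_closedBall ℂ L2 0 B
  obtain ⟨a, -, φ, hφ, ha⟩ := hc
    (x := fun k => StrongDual.toWeakDual (InnerProductSpace.toDual ℂ L2 (f k)))
    (fun k => by
      change InnerProductSpace.toDual ℂ L2 (f k) ∈ Metric.closedBall 0 B
      rw [mem_closedBall_zero_iff, LinearIsometryEquiv.norm_map]; exact hB k)
  refine ⟨(InnerProductSpace.toDual ℂ L2).symm (WeakDual.toStrongDual a), φ, hφ, fun g => ?_⟩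
  have h1 : Tendsto (fun k => inner ℂ (f (φ k)) g) atTop (𝓝 (a g)) :=
    ((WeakDual.eval_continuous g).tendsto a).comp ha
  have h2 : a g = inner ℂ ((InnerProductSpace.toDual ℂ L2).symm (WeakDual.toStrongDual a)) g := by
    rw [InnerProductSpace.toDual_symm_apply]; rfl
  rw [h2] at h1
  have h3 := (Complex.continuous_conj.tendsto _).comp h1
  simp only [Function.comp_def, inner_conj_symm] at h3
  exact h3

/-- Coercivity on the `L²` unit sphere: the potential costs at most one unit of `‖f‖²`, and `2π² - 1
≥ 1`. -/
theorem IsFormSmall.exists_le_energyForm {V : E3 → ℝ} (hV : IsFormSmall V) :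
    ∃ C : ℝ, ∀ f : L2, ‖bessel f‖ = 1 → ‖f‖ ^ 2 ≤ energyForm V f + C := by
  obtain ⟨M, -, h⟩ := hV.exists_neg_le_potForm one_pos
  refine ⟨2 * π ^ 2 + M, fun f hf => ?_⟩
  have h1 := h f
  have h2 : (9 : ℝ) ≤ π ^ 2 := by nlinarith [Real.pi_gt_three]
  rw [energyForm, hf]
  rw [hf] at h1
  nlinarith [sq_nonneg ‖f‖]

/-- The energy is weakly sequentially lower semicontinuous on `H¹`. -/
theorem IsFormSmall.energyForm_le_of_tendsto {V : E3 → ℝ} (hV : IsFormSmall V) {f : ℕ → L2}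
    {f₀ : L2} {B m : ℝ} (hB : ∀ k, ‖f k‖ ≤ B)
    (hf : ∀ g : L2, Tendsto (fun k => inner ℂ g (f k)) atTop (𝓝 (inner ℂ g f₀)))
    (hm : Tendsto (fun k => energyForm V (f k)) atTop (𝓝 m)) : energyForm V f₀ ≤ m := by
  have h1 := hV.tendsto_potForm hB hf
  have hre : ∀ g : L2, Tendsto (fun k => (inner ℂ g (f k)).re) atTop (𝓝 (inner ℂ g f₀).re) :=
    fun g => (Complex.continuous_re.tendsto _).comp (hf g)
  have h2 := hre f₀
  have h3 := hre (bessel.adjoint (bessel f₀))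
  simp_rw [ContinuousLinearMap.adjoint_inner_left] at h3
  have hself : ∀ u : L2, (inner ℂ u u).re = ‖u‖ ^ 2 := fun u => by
    have := inner_self_eq_norm_sq (𝕜 := ℂ) u; exact this
  -- Let `Q(f) = ‖f‖² - ‖bessel f‖² ≥ 0`, with associated sesquilinear form `Q(·,·)`. From `Q(f k -
  -- f₀) ≥ 0` follows `Q(f k) ≥ 2 Re Q(f₀, f k) - Q(f₀)`, whose right side converges weakly to
  -- `Q(f₀)`.
  have h4 := ((((h2.sub h3).const_mul 2).sub_const (‖f₀‖ ^ 2 - ‖bessel f₀‖ ^ 2)).const_mul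
    (2 * π ^ 2)).add h1
  have e : 2 * π ^ 2 * (2 * ((inner ℂ f₀ f₀).re - (inner ℂ (bessel f₀) (bessel f₀)).re) -
      (‖f₀‖ ^ 2 - ‖bessel f₀‖ ^ 2)) + potForm V f₀ = energyForm V f₀ := by
    rw [hself, hself, energyForm]; ring
  rw [e] at h4
  refine le_of_tendsto_of_tendsto' h4 hm fun k => ?_
  rw [energyForm]
  refine add_le_add (mul_le_mul_of_nonneg_left ?_ (by positivity)) le_rfl
  have h5 := norm_bessel_le (f k - f₀)
  have h6 : ‖bessel (f k - f₀)‖ ^ 2 ≤ ‖f k - f₀‖ ^ 2 := by gcongr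
  rw [map_sub, norm_sub_sq (𝕜 := ℂ), norm_sub_sq (𝕜 := ℂ)] at h6
  have h7 := inner_re_symm (𝕜 := ℂ) (f k) f₀
  have h8 := inner_re_symm (𝕜 := ℂ) (bessel (f k)) (bessel f₀)
  simp only [RCLike.re_to_complex] at h6 h7 h8
  linarith

/-- A negative infimum `m` prevents loss of mass: for the weak limit `χ`, homogeneity gives `m ‖χ‖²
≤ E χ ≤ m < 0`, which forces `‖χ‖ ≥ 1`. -/
theorem exists_isMinOn_lumoSet {Φ : Fin n → L2}
    {E : L2 → ℝ} {V : E3 → ℝ} (hV : IsFormSmall V) (hE : ∀ f, E (bessel f) = energyForm V f)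
    (hneg : ∃ χ ∈ lumoSet Φ, E χ < 0) : ∃ φ ∈ lumoSet Φ, IsMinOn E (lumoSet Φ) φ := by
  obtain ⟨χ₀, hχ₀, hχ₀neg⟩ := hneg
  obtain ⟨C, hC⟩ := hV.exists_le_energyForm
  have hbdd : BddBelow (E '' lumoSet Φ) := by
    refine ⟨-C, ?_⟩
    rintro _ ⟨χ, ⟨hχ, -, hχ1⟩, rfl⟩
    obtain ⟨f, rfl⟩ := mem_H1_iff.1 hχ
    rw [hE]
    linarith [hC f hχ1, sq_nonneg ‖f‖]
  set m := sInf (E '' lumoSet Φ) with hm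
  have hm0 : m < 0 := (csInf_le hbdd ⟨χ₀, hχ₀, rfl⟩).trans_lt hχ₀neg
  obtain ⟨u, hanti, hlim, hu⟩ := exists_seq_tendsto_sInf
    (Set.Nonempty.image E ⟨χ₀, hχ₀⟩) hbdd
  choose χ hχ hχu using hu
  choose f hf using fun k => mem_H1_iff.1 (hχ k).1
  have hfu : ∀ k, energyForm V (f k) = u k := fun k => by rw [← hE, hf, hχu]
  have hf1 : ∀ k, ‖bessel (f k)‖ = 1 := fun k => by rw [hf]; exact (hχ k).2.2
  have hB : ∀ k, ‖f k‖ ≤ √(u 0 + C) := fun k => by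
    refine Real.le_sqrt_of_sq_le ((hC _ (hf1 k)).trans ?_)
    rw [hfu]
    linarith [hanti (Nat.zero_le k)]
  obtain ⟨f₀, φ, hφ, hw⟩ := exists_subseq_weakly_tendsto hB
  have hle : energyForm V f₀ ≤ m := by
    refine hV.energyForm_le_of_tendsto (fun k => hB (φ k)) hw ?_
    simp_rw [hfu]
    exact hlim.comp hφ.tendsto_atTop
  have hwb : ∀ g : L2, Tendsto (fun k => inner ℂ g (bessel (f (φ k)))) atTop
      (𝓝 (inner ℂ g (bessel f₀))) := fun g => by
    have := hw (bessel.adjoint g)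
    simpa only [ContinuousLinearMap.adjoint_inner_left] using this
  have horth : ∀ k, inner ℂ (Φ k) (bessel f₀) = 0 := fun k => by
    refine tendsto_nhds_unique (hwb (Φ k)) ?_
    have : ∀ j, inner ℂ (Φ k) (bessel (f (φ j))) = 0 := fun j => by
      rw [hf]; exact (hχ (φ j)).2.1 k
    simp_rw [this]
    exact tendsto_const_nhds
  have hb0 : bessel f₀ ≠ 0 := fun h => by
    have h0 : f₀ = 0 := bessel_injective (by rw [h, map_zero])
    have : energyForm V f₀ = 0 := by
      have := energyForm_smul V 0 f₀
      rw [zero_smul] at this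
      rw [h0, this]; simp
    linarith
  have hb0' : 0 < ‖bessel f₀‖ := norm_pos_iff.2 hb0
  have hnorm_le : ‖bessel f₀‖ ≤ 1 := by
    have h1 := (hwb (bessel f₀)).norm
    have h2 : ‖inner ℂ (bessel f₀) (bessel f₀)‖ ≤ ‖bessel f₀‖ := by
      refine le_of_tendsto h1 (Eventually.of_forall fun k => ?_)
      refine (norm_inner_le_norm _ _).trans ?_
      rw [hf1, mul_one]
    rw [inner_self_eq_norm_sq_to_K, norm_pow, RCLike.norm_ofReal, abs_norm] at h2
    nlinarith
  have hscale : m * ‖bessel f₀‖ ^ 2 ≤ energyForm V f₀ := by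
    set c : ℂ := ((‖bessel f₀‖⁻¹ : ℝ) : ℂ)
    have hc : ‖c‖ = ‖bessel f₀‖⁻¹ := by simp [c]
    have hmem : bessel (c • f₀) ∈ lumoSet Φ := by
      refine ⟨bessel_mem_H1 _, fun k => ?_, ?_⟩
      · rw [map_smul, inner_smul_right, horth, mul_zero]
      · rw [map_smul, norm_smul, hc, inv_mul_cancel₀ hb0'.ne']
    have h1 : m ≤ E (bessel (c • f₀)) := csInf_le hbdd ⟨_, hmem, rfl⟩
    rw [hE, energyForm_smul, hc, inv_pow, ← div_eq_inv_mul, le_div_iff₀ (by positivity)] at h1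
    exact h1
  have hnorm : ‖bessel f₀‖ = 1 := by
    refine le_antisymm hnorm_le ?_
    by_contra h
    have h2 : ‖bessel f₀‖ ^ 2 < 1 := by nlinarith [not_le.1 h]
    nlinarith
  refine ⟨bessel f₀, ⟨bessel_mem_H1 _, horth, hnorm⟩, fun χ' hχ' => ?_⟩
  rw [mem_ofPred_eq, hE]
  exact hle.trans (csInf_le hbdd ⟨χ', hχ', rfl⟩)

end

section

/-! ### Trial functions -/

/-- The cutoff function, with values in `ℂ`. -/
def bump (x : E3) : ℂ := ((cutoff x : ℝ) : ℂ)

theorem contDiff_bump : ContDiff ℝ ((⊤ : ℕ∞) : WithTop ℕ∞) bump :=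
  Complex.ofRealCLM.contDiff.comp cutoff.contDiff

theorem hasCompactSupport_bump : HasCompactSupport bump :=
  cutoff.hasCompactSupport.comp_left (g := fun t : ℝ => (t : ℂ)) Complex.ofReal_zero

theorem norm_bump (x : E3) : ‖bump x‖ = cutoff x := by
  rw [bump, Complex.norm_real, Real.norm_eq_abs, abs_of_nonneg cutoff.nonneg]

theorem contDiff_scaled_bump (s : ℝ) :
    ContDiff ℝ ((⊤ : ℕ∞) : WithTop ℕ∞) ((s ^ 3 : ℝ) • fun x : E3 => bump (s ^ 2 • x)) := by
  have h : ContDiff ℝ ((⊤ : ℕ∞) : WithTop ℕ∞) fun x : E3 => bump (s ^ 2 • x) :=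
    contDiff_bump.comp (contDiff_const_smul (s ^ 2))
  exact contDiff_const.smul h

/-- The scaled bump function `s³ η(s² x)`, of constant `L²`-norm. -/
def trial {s : ℝ} (hs : 0 < s) : 𝓢(E3, ℂ) :=
  HasCompactSupport.toSchwartzMap (f := (s ^ 3 : ℝ) • fun x : E3 => bump (s ^ 2 • x))
    ((hasCompactSupport_bump.comp_smul (pow_ne_zero 2 hs.ne')).smul_left
      (f := fun _ : E3 => (s ^ 3 : ℝ)))
    (contDiff_scaled_bump s)

variable {s : ℝ} (hs : 0 < s)

theorem coe_trial : ⇑(trial hs) = (s ^ 3 : ℝ) • fun x : E3 => bump (s ^ 2 • x) := rfl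

theorem norm_trial (x : E3) : ‖trial hs x‖ = s ^ 3 * cutoff (s ^ 2 • x) := by
  rw [coe_trial, Pi.smul_apply, norm_smul, norm_bump, Real.norm_eq_abs,
    abs_of_nonneg (by positivity)]

theorem integral_comp_sq_smul (F : E3 → ℝ) :
    ∫ x, F (s ^ 2 • x) = (s ^ 6)⁻¹ * ∫ x, F x := by
  have := Measure.integral_comp_smul_of_nonneg (volume : Measure E3) F (s ^ 2)
    (hR := by positivity)
  rw [this, smul_eq_mul, finrank_euclideanSpace_fin]
  ring

theorem fderiv_trial (x v : E3) :
    fderiv ℝ (trial hs) x v = (s ^ 5 : ℝ) • fderiv ℝ bump (s ^ 2 • x) v := by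
  have hd : DifferentiableAt ℝ (fun x : E3 => bump (s ^ 2 • x)) x :=
    ((contDiff_bump.comp (contDiff_const_smul (s ^ 2))).differentiable (by simp)) x
  rw [coe_trial, fderiv_const_smul hd, fderiv_comp_smul]
  simp only [smul_apply, smul_smul]
  congr 1; ring

/-- Scaling: the squared gradient carries `s¹⁰` and the change of variables `s⁻⁶`. -/
theorem exists_integral_sum_weakPartial_trial : ∃ K : ℝ, 0 ≤ K ∧ ∀ {s : ℝ} (hs : 0 < s),
    ∫ x, ∑ i, ‖weakPartial i ((trial hs).toLp 2) x‖ ^ 2 = s ^ 4 * K := by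
  refine ⟨∑ i : Fin 3, ∫ x, ‖fderiv ℝ bump x (EuclideanSpace.single i 1)‖ ^ 2,
    Finset.sum_nonneg fun i _ => integral_nonneg fun x => by positivity, fun {s} hs => ?_⟩
  rw [integral_finsetSum _ (fun i _ => integrable_norm_sq _), Finset.mul_sum]
  refine Finset.sum_congr rfl fun i _ => ?_
  rw [weakPartial_eq (isWeakPartial_toLp i (trial hs))]
  have h1 : ∫ x, ‖((∂_{(EuclideanSpace.single i (1 : ℝ) : E3)} (trial hs) : 𝓢(E3, ℂ)).toLp 2
      : L2) x‖ ^ 2 =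
      ∫ x, s ^ 10 * ‖fderiv ℝ bump (s ^ 2 • x) (EuclideanSpace.single i 1)‖ ^ 2 := by
    refine integral_congr_ae ?_
    filter_upwards [SchwartzMap.coeFn_toLp
      (∂_{(EuclideanSpace.single i (1 : ℝ) : E3)} (trial hs) : 𝓢(E3, ℂ)) 2 volume] with x hx
    rw [hx, SchwartzMap.lineDerivOp_apply_eq_fderiv, fderiv_trial, norm_smul, mul_pow,
      Real.norm_eq_abs, abs_of_nonneg (by positivity)]
    ring
  rw [h1, integral_const_mul,
    integral_comp_sq_smul (s := s) (fun x => ‖fderiv ℝ bump x (EuclideanSpace.single i 1)‖ ^ 2)]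
  field_simp

theorem norm_sq_trial :
    ‖(trial hs).toLp 2 (volume : Measure E3)‖ ^ 2 = ∫ x : E3, cutoff x ^ 2 := by
  rw [norm_sq_eq_integral]
  have h1 : ∫ x, ‖((trial hs).toLp 2 : L2) x‖ ^ 2 = ∫ x, s ^ 6 * cutoff (s ^ 2 • x) ^ 2 := by
    refine integral_congr_ae ?_
    filter_upwards [SchwartzMap.coeFn_toLp (trial hs) 2 volume] with x hx
    rw [hx, norm_trial]; ring
  rw [h1, integral_const_mul, integral_comp_sq_smul (s := s) (fun x => cutoff x ^ 2)]
  field_simp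

theorem toLp_mem_H1 (u : 𝓢(E3, ℂ)) : (u.toLp 2 : L2) ∈ H1 := by
  change MemSobolev 1 2 _
  rw [Lp.toTemperedDistribution_toLp_eq]
  exact u.memSobolev

/-! ### Coulomb energies of the trial functions -/

/-- The Coulomb potential of the charge density `η²`. -/
def bumpPot (z : E3) : ℝ := ∫ x, 1 / ‖x - z‖ * cutoff x ^ 2

theorem bumpPot_nonneg (z : E3) : 0 ≤ bumpPot z := integral_nonneg fun x => by positivity

/-- The kernel is homogeneous of degree `-1` under the dilation by `s²`, which leaves the decisive
factor `s²`. -/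
theorem integral_kernel_trial (y : E3) :
    ∫ x, 1 / ‖x - y‖ * ‖trial hs x‖ ^ 2 = s ^ 2 * bumpPot (s ^ 2 • y) := by
  have h1 : ∀ x, 1 / ‖x - y‖ * ‖trial hs x‖ ^ 2 =
      s ^ 8 * (1 / ‖s ^ 2 • x - s ^ 2 • y‖ * cutoff (s ^ 2 • x) ^ 2) := fun x => by
    rw [norm_trial, ← smul_sub, norm_smul, Real.norm_eq_abs, abs_of_nonneg (by positivity)]
    field_simp
  simp_rw [h1]
  rw [integral_const_mul, integral_comp_sq_smul (s := s)
    (fun x => 1 / ‖x - s ^ 2 • y‖ * cutoff x ^ 2), bumpPot]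
  field_simp

theorem stronglyMeasurable_bumpPot : StronglyMeasurable bumpPot := by
  have h : StronglyMeasurable (Function.uncurry fun (z x : E3) => 1 / ‖x - z‖ * cutoff x ^ 2) := by
    refine Measurable.stronglyMeasurable ?_
    have := cutoff.continuous.measurable
    unfold Function.uncurry; fun_prop
  exact h.integral_prod_right

theorem integrable_kernel_prod (ν : Measure E3) [IsFiniteMeasure ν] (f : L2) :
    Integrable (Function.uncurry fun (x y : E3) => 1 / ‖x - y‖ * ‖bessel f x‖ ^ 2)
      ((volume : Measure E3).prod ν) := by
  have hm : Measurable (Function.uncurry fun (x y : E3) => 1 / ‖x - y‖ * ‖bessel f x‖ ^ 2) := by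
    have := (Lp.stronglyMeasurable (bessel f)).measurable
    unfold Function.uncurry; fun_prop
  refine ⟨hm.aestronglyMeasurable, ?_⟩
  obtain ⟨C, hC, h⟩ := exists_lintegral_kernel_le
  rw [hasFiniteIntegral_iff_enorm, lintegral_prod_symm _ hm.enorm.aemeasurable]
  simp only [Function.uncurry_apply_pair, enorm_mul_norm_sq]
  refine (lintegral_mono fun y => h y f).trans_lt ?_
  rw [lintegral_const]
  exact ENNReal.mul_lt_top ENNReal.ofReal_lt_top (measure_lt_top _ _)

theorem potForm_coulombPot (ν : Measure E3) [IsFiniteMeasure ν] (f : L2) :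
    potForm (coulombPot ν) f = ∫ y, ∫ x, 1 / ‖x - y‖ * ‖bessel f x‖ ^ 2 ∂volume ∂ν := by
  rw [← integral_integral_swap (integrable_kernel_prod ν f), potForm]
  refine integral_congr_ae (Eventually.of_forall fun x => ?_)
  simp only [coulombPot]
  rw [integral_mul_const]

theorem integral_kernel_toLp (u : 𝓢(E3, ℂ)) (y : E3) :
    ∫ x, 1 / ‖x - y‖ * ‖(u.toLp 2 : L2) x‖ ^ 2 = ∫ x, 1 / ‖x - y‖ * ‖u x‖ ^ 2 := by
  refine integral_congr_ae ?_
  filter_upwards [SchwartzMap.coeFn_toLp u 2 volume] with x hx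
  rw [hx]

theorem potForm_coulombPot_trial (ν : Measure E3) [IsFiniteMeasure ν] {f : L2}
    (hf : bessel f = (trial hs).toLp 2) :
    potForm (coulombPot ν) f = s ^ 2 * ∫ y, bumpPot (s ^ 2 • y) ∂ν := by
  rw [potForm_coulombPot, hf, ← integral_const_mul]
  refine integral_congr_ae (Eventually.of_forall fun y => ?_)
  beta_reduce
  rw [integral_kernel_toLp, integral_kernel_trial]

/-- At `s = 1` the trial function is `η` itself, so the kernel bound uniform in position applies. -/
theorem exists_bumpPot_le : ∃ C : ℝ, ∀ z, bumpPot z ≤ C := by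
  obtain ⟨f, hf⟩ := mem_H1_iff.1 (toLp_mem_H1 (trial one_pos))
  obtain ⟨C, hC, h⟩ := exists_lintegral_kernel_le
  refine ⟨C * ‖f‖ ^ 2, fun z => ?_⟩
  have e : bumpPot z = ∫ x, 1 / ‖x - z‖ * ‖bessel f x‖ ^ 2 := by
    rw [hf, integral_kernel_toLp, integral_kernel_trial]; simp
  rw [e, integral_eq_lintegral_of_nonneg_ae (Eventually.of_forall fun x => by positivity)]
  · refine ENNReal.toReal_le_of_le_ofReal (by positivity) ((le_of_eq ?_).trans (h z f))
    refine lintegral_congr fun x => ?_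
    rw [← enorm_mul_norm_sq, ← ofReal_norm, Real.norm_eq_abs, abs_of_nonneg (by positivity)]
  · exact (measurable_const.div (measurable_id.sub_const z).norm).aestronglyMeasurable.mul
      (integrable_norm_sq _).aestronglyMeasurable

theorem integrable_ball_inv_norm (R : ℝ) :
    Integrable ((Metric.ball (0 : E3) R).indicator fun w => 1 / ‖w‖) volume := by
  rw [integrable_indicator_iff measurableSet_ball]
  refine integrableOn_ball_of_norm_le_rpow (by simp) (C := 1) (α := 1) (by norm_num)
    (Eventually.of_forall fun w => ?_) (measurable_norm.const_div 1).aestronglyMeasurable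
  rw [Real.rpow_neg_one, one_mul, one_div, norm_inv, norm_norm]

theorem cutoff_eq_zero {x : E3} (hx : 2 ≤ ‖x‖) : cutoff x = 0 :=
  cutoff.zero_of_le_dist (by rw [dist_zero_right]; exact hx)

theorem cutoff_sq_le_one (x : E3) : cutoff x ^ 2 ≤ 1 :=
  pow_le_one₀ cutoff.nonneg cutoff.le_one

/-- Translating the variable keeps the singularity at the origin; for `|z| < 1` the integrands are
dominated by `1 / |w|` on the ball of radius `2 + 1`. -/
theorem tendsto_bumpPot_zero : Tendsto bumpPot (𝓝 0) (𝓝 (bumpPot 0)) := by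
  have e : bumpPot = fun z => ∫ w, 1 / ‖w‖ * cutoff (w + z) ^ 2 := by
    ext z
    rw [bumpPot, ← integral_add_right_eq_self _ z]
    simp
  rw [e]
  refine tendsto_integral_filter_of_dominated_convergence
    ((Metric.ball (0 : E3) 3).indicator fun w => 1 / ‖w‖) ?_ ?_ (integrable_ball_inv_norm 3) ?_
  · refine Eventually.of_forall fun z => Measurable.aestronglyMeasurable ?_
    have := cutoff.continuous.measurable
    fun_prop
  · filter_upwards [Metric.ball_mem_nhds (0 : E3) one_pos] with z hz
    refine Eventually.of_forall fun w => ?_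
    have hz' : ‖z‖ < 1 := by simpa using hz
    rw [Real.norm_eq_abs, abs_of_nonneg (by positivity)]
    by_cases hw : w ∈ Metric.ball (0 : E3) 3
    · rw [indicator_of_mem hw]
      exact mul_le_of_le_one_right (by positivity) (cutoff_sq_le_one _)
    · rw [indicator_of_notMem hw]
      have hw' : 3 ≤ ‖w‖ := by simpa using hw
      have := norm_sub_norm_le w (-z)
      rw [norm_neg, sub_neg_eq_add] at this
      rw [cutoff_eq_zero (by linarith)]
      simp
  · refine Eventually.of_forall fun w => ?_
    have hc := cutoff.continuous
    have : Continuous fun z => 1 / ‖w‖ * cutoff (w + z) ^ 2 := by fun_prop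
    exact this.tendsto 0

theorem bumpPot_zero_pos : 0 < bumpPot 0 := by
  have hi : Integrable (fun x : E3 => 1 / ‖x - 0‖ * cutoff x ^ 2) volume := by
    have hc := cutoff.continuous.measurable
    refine (integrable_ball_inv_norm 2).mono' (Measurable.aestronglyMeasurable (by fun_prop))
      (Eventually.of_forall fun w => ?_)
    rw [Real.norm_eq_abs, abs_of_nonneg (by positivity), sub_zero]
    by_cases hw : w ∈ Metric.ball (0 : E3) 2
    · rw [indicator_of_mem hw]
      exact mul_le_of_le_one_right (by positivity) (cutoff_sq_le_one _)
    · rw [indicator_of_notMem hw, cutoff_eq_zero (by simpa using hw)]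
      simp
  rw [bumpPot, integral_pos_iff_support_of_nonneg (fun x => by positivity) hi]
  -- The centre is removed because `1 / 0 = 0` makes the integrand vanish there.
  have hsub : Metric.ball (0 : E3) 1 \ {0} ⊆
      Function.support fun x : E3 => 1 / ‖x - 0‖ * cutoff x ^ 2 := by
    rintro x ⟨hx, hx0⟩
    have h1 : cutoff x = 1 := cutoff.one_of_mem_closedBall (Metric.ball_subset_closedBall hx)
    have h2 : ‖x‖ ≠ 0 := norm_ne_zero_iff.2 hx0
    simp [Function.mem_support, h1, h2]
  refine lt_of_lt_of_le ?_ (measure_mono hsub)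
  rw [measure_sdiff_null (measure_singleton _)]
  exact Metric.measure_ball_pos _ _ one_pos

/-- On the scale of the trial function the whole charge collapses to the origin, so only its total
survives. This is how the comparison of `N` with `Z` enters. -/
theorem tendsto_integral_bumpPot (ν : Measure E3) [IsFiniteMeasure ν] {t : ℕ → ℝ}
    (ht : Tendsto t atTop (𝓝 0)) :
    Tendsto (fun j => ∫ y, bumpPot (t j ^ 2 • y) ∂ν) atTop (𝓝 (ν.real univ * bumpPot 0)) := by
  obtain ⟨C, hC⟩ := exists_bumpPot_le
  have e : ν.real univ * bumpPot 0 = ∫ _, bumpPot 0 ∂ν := by simp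
  rw [e]
  refine tendsto_integral_of_dominated_convergence (fun _ => C) (fun j => ?_) (integrable_const C)
    (fun j => Eventually.of_forall fun y => ?_) (Eventually.of_forall fun y => ?_)
  · exact (stronglyMeasurable_bumpPot.comp_measurable
      (measurable_const_smul (t j ^ 2))).aestronglyMeasurable
  · rw [Real.norm_eq_abs, abs_of_nonneg (bumpPot_nonneg _)]
    exact hC _
  · refine tendsto_bumpPot_zero.comp ?_
    have := (ht.pow 2).smul_const y
    simpa using this

/-! ### Exponential decay -/

theorem memLp_exp_neg_norm {γ : ℝ} (hγ : 0 < γ) :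
    MemLp (fun x : E3 => Real.exp (-(γ * ‖x‖))) 2 volume := by
  have hc : Continuous fun x : E3 => Real.exp (-(γ * ‖x‖)) := by fun_prop
  rw [memLp_two_iff_integrable_sq hc.aestronglyMeasurable]
  -- With this `m`, `exp (γ r / 2) ≥ 1 + γ r / 2 ≥ m (1 + r)`; the fourth power is integrable after
  -- inversion because `4 > 3`.
  have hm : 0 < min 1 (γ / 2) := by positivity
  set m := min 1 (γ / 2)
  have hi := (integrable_one_add_norm (μ := (volume : Measure E3)) (r := 4)
    (by rw [finrank_euclideanSpace_fin]; norm_num)).const_mul ((m ^ 4)⁻¹)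
  refine hi.mono' (hc.pow 2).aestronglyMeasurable (Eventually.of_forall fun x => ?_)
  rw [Real.norm_eq_abs, abs_of_nonneg (by positivity), ← Real.exp_nat_mul,
    Real.rpow_neg (by positivity), ← mul_inv]
  have e1 : ((2 : ℕ) : ℝ) * -(γ * ‖x‖) = -(((4 : ℕ) : ℝ) * (γ / 2 * ‖x‖)) := by push_cast; ring
  rw [e1, Real.exp_neg, Real.exp_nat_mul]
  refine inv_anti₀ (by positivity) ?_
  rw [show (4 : ℝ) = ((4 : ℕ) : ℝ) by norm_num, Real.rpow_natCast, ← mul_pow]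
  gcongr
  refine le_trans ?_ (Real.add_one_le_exp _)
  have h1 : m ≤ 1 := min_le_left _ _
  have h2 : m ≤ γ / 2 := min_le_right _ _
  nlinarith [mul_le_mul_of_nonneg_right h2 (norm_nonneg x)]

variable {n : ℕ}

/-- The orbital is the product of `e^{-γ|x|}` and `e^{γ|x|} φⱼ`, both in `L²`. -/
theorem ExpDecay.integrable {Φ : Fin n → L2} (h : ExpDecay Φ) (j : Fin n) :
    Integrable (Φ j) volume := by
  obtain ⟨γ, hγ, h⟩ := h
  obtain ⟨u, -, hu⟩ := h j
  have h1 := (memLp_exp_neg_norm hγ).ofReal.integrable_mul (𝕜 := ℂ) (Lp.memLp u)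
  refine h1.congr ?_
  filter_upwards [hu] with x hx
  rw [Pi.mul_apply, hx, ← mul_assoc]
  have : ((Real.exp (-(γ * ‖x‖)) : ℝ) : ℂ) * ((Real.exp (γ * ‖x‖) : ℝ) : ℂ) = 1 := by
    rw [← Complex.ofReal_mul, ← Real.exp_add]; simp
  have e := congrArg (· * Φ j x) this
  simpa using e

/-- Pairs `L¹` with the sup norm `s³` of the trial function; Cauchy–Schwarz would give no decay in
`s`. -/
theorem norm_inner_trial_le {φ : L2} (hφ : Integrable φ volume) :
    ‖inner ℂ φ ((trial hs).toLp 2 (volume : Measure E3))‖ ≤ s ^ 3 * ∫ x, ‖φ x‖ := by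
  rw [L2.inner_def, ← integral_const_mul]
  refine norm_integral_le_of_norm_le (hφ.norm.const_mul _) ?_
  filter_upwards [SchwartzMap.coeFn_toLp (trial hs) 2 volume] with x hx
  rw [hx]
  refine (norm_inner_le_norm _ _).trans ?_
  rw [norm_trial, mul_comm]
  gcongr
  exact mul_le_of_le_one_right (by positivity) cutoff.le_one

end

section

/-! ### The energy is negative somewhere on the LUMO set -/

variable {n : ℕ}

theorem potForm_totalPot_le {exc : ℝ → ℝ} (hexc : AdmissibleXC exc) (μ : Measure E3)
    [IsFiniteMeasure μ] (Φ : Fin n → L2) (f : L2) :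
    potForm (totalPot exc μ (density Φ)) f ≤
      potForm (coulombPot (densityMeasure Φ)) f - potForm (coulombPot μ) f := by
  have h1 := (isFormSmall_coulombPot (densityMeasure Φ)).integrable f
  have h2 := (isFormSmall_coulombPot μ).integrable f
  rw [potForm, potForm, potForm, ← integral_sub h1 h2]
  refine integral_mono ((isFormSmall_totalPot hexc μ Φ).integrable f) (h1.sub h2) fun x => ?_
  have h3 := hexc.vxc_nonpos _ (density_nonneg Φ x)
  have h4 : totalPot exc μ (density Φ) x ≤
      coulombPot (densityMeasure Φ) x - coulombPot μ x := by
    rw [totalPot, vHartree_density, vext_eq]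
    linarith
  simp only [← sub_mul]
  exact mul_le_mul_of_nonneg_right h4 (by positivity)

/-- The bound `B` on `‖f‖²`, uniform for `s ≤ 1`, keeps the Lipschitz cost of the later
orthogonalisation of order `s³`. -/
theorem exists_energyForm_trial_le {exc : ℝ → ℝ} (hexc : AdmissibleXC exc) (μ : Measure E3)
    [IsFiniteMeasure μ] (Φ : Fin n → L2) :
    ∃ K B : ℝ, 0 ≤ B ∧ ∀ {s : ℝ} (hs : 0 < s), s ≤ 1 → ∃ f : L2,
      bessel f = (trial hs).toLp 2 ∧ ‖f‖ ^ 2 ≤ B ∧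
      energyForm (totalPot exc μ (density Φ)) f ≤ s ^ 4 * K + s ^ 2 *
        ((∫ y, bumpPot (s ^ 2 • y) ∂(densityMeasure Φ)) - ∫ y, bumpPot (s ^ 2 • y) ∂μ) := by
  obtain ⟨K, hK, h⟩ := exists_integral_sum_weakPartial_trial
  have hc : 0 ≤ ∫ x : E3, cutoff x ^ 2 := integral_nonneg fun x => by positivity
  refine ⟨1 / 2 * K, (∫ x : E3, cutoff x ^ 2) + K, by positivity, fun {s} hs hs1 => ?_⟩
  obtain ⟨f, hf⟩ := mem_H1_iff.1 (toLp_mem_H1 (trial hs))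
  have h1 := integral_sum_weakPartial_bessel f
  rw [hf, h hs] at h1
  have h2 := norm_sq_trial hs
  refine ⟨f, hf, ?_, ?_⟩
  · rw [h2] at h1
    have h3 : s ^ 4 * K ≤ K := mul_le_of_le_one_left hK (pow_le_one₀ hs.le hs1)
    have h4 : (1 : ℝ) ≤ 4 * π ^ 2 := by nlinarith [Real.pi_gt_three]
    nlinarith [mul_nonneg (pow_nonneg hs.le 4) hK]
  · have h3 := potForm_totalPot_le hexc μ Φ f
    rw [potForm_coulombPot_trial hs _ hf, potForm_coulombPot_trial hs _ hf] at h3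
    rw [energyForm, hf]
    linarith

/-- The component of a function orthogonal to the orbitals. -/
theorem inner_sub_sum_eq_zero {Φ : Fin n → L2} (hΦ : Orthonormal ℂ Φ) (χ : L2) (k : Fin n) :
    inner ℂ (Φ k) (χ - ∑ j, inner ℂ (Φ j) χ • Φ j) = 0 := by
  rw [inner_sub_right, hΦ.inner_right_fintype, sub_self]

theorem exists_lumoSet_of_energyForm_neg {Φ : Fin n → L2} {V : E3 → ℝ} {f : L2}
    (horth : ∀ k, inner ℂ (Φ k) (bessel f) = 0) (hneg : energyForm V f < 0) :
    ∃ g : L2, bessel g ∈ lumoSet Φ ∧ energyForm V g < 0 := by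
  have hb0 : bessel f ≠ 0 := fun h => by
    have h0 : f = 0 := bessel_injective (by rw [h, map_zero])
    have h1 := energyForm_smul V 0 f
    rw [zero_smul, ← h0] at h1
    rw [h1] at hneg
    simp at hneg
  have hb : 0 < ‖bessel f‖ := norm_pos_iff.2 hb0
  set c : ℂ := ((‖bessel f‖⁻¹ : ℝ) : ℂ)
  have hc : ‖c‖ = ‖bessel f‖⁻¹ := by simp [c]
  refine ⟨c • f, ⟨bessel_mem_H1 _, fun k => ?_, ?_⟩, ?_⟩
  · rw [map_smul, inner_smul_right, horth, mul_zero]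
  · rw [map_smul, norm_smul, hc, inv_mul_cancel₀ hb.ne']
  · rw [energyForm_smul, hc]
    exact mul_neg_of_pos_of_neg (by positivity) hneg

theorem exists_lumoSet_neg {exc : ℝ → ℝ} (hexc : AdmissibleXC exc) (μ : Measure E3)
    [IsFiniteMeasure μ] {Φ : Fin n → L2} (hΦ : Φ ∈ orbitalSet n)
    (hμ : (2 * n : ℝ) < μ.real univ) (hdec : ExpDecay Φ) :
    ∃ χ ∈ lumoSet Φ, excitationEnergy exc μ (density Φ) χ < 0 := by
  have hV := isFormSmall_totalPot hexc μ Φ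
  set V := totalPot exc μ (density Φ)
  obtain ⟨C, hC, hpert⟩ := hV.exists_abs_energyForm_add_sub_le
  obtain ⟨K, B, hB, htrial⟩ := exists_energyForm_trial_le hexc μ Φ
  choose f hf using fun k => mem_H1_iff.1 (hΦ.1 k)
  set D : ℝ := ∑ k, (∫ x, ‖Φ k x‖) * ‖f k‖ with hD
  have hD0 : 0 ≤ D := Finset.sum_nonneg fun k _ =>
    mul_nonneg (integral_nonneg fun x => norm_nonneg _) (norm_nonneg _)
  let t : ℕ → ℝ := fun j => 1 / ((j : ℝ) + 1)
  have ht0 : ∀ j, 0 < t j := fun j => by positivity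
  have ht1 : ∀ j, t j ≤ 1 := fun j => by
    rw [div_le_one (by positivity)]; linarith [Nat.cast_nonneg (α := ℝ) j]
  have ht : Tendsto t atTop (𝓝 0) := tendsto_one_div_add_atTop_nhds_zero_nat
  have hν : (densityMeasure Φ).real univ = 2 * n := by
    rw [measureReal_def, densityMeasure_univ, integral_density hΦ,
      ENNReal.toReal_ofReal (by positivity)]
  -- This is the energy bound divided by `s²`: the correction of size `s³ D` contributes `s D (1 +
  -- B) + s⁴ D²`.
  have hlim : Tendsto (fun j => t j ^ 2 * K +
      ((∫ y, bumpPot (t j ^ 2 • y) ∂(densityMeasure Φ)) - ∫ y, bumpPot (t j ^ 2 • y) ∂μ) +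
      C * (t j * D * (1 + B) + t j ^ 4 * D ^ 2)) atTop
      (𝓝 (0 ^ 2 * K + ((densityMeasure Φ).real univ * bumpPot 0 - μ.real univ * bumpPot 0) +
        C * (0 * D * (1 + B) + 0 ^ 4 * D ^ 2))) :=
    (((ht.pow 2).mul_const K).add ((tendsto_integral_bumpPot _ ht).sub
      (tendsto_integral_bumpPot _ ht))).add
      ((((ht.mul_const D).mul_const (1 + B)).add ((ht.pow 4).mul_const (D ^ 2))).const_mul C)
  have hlimneg : 0 ^ 2 * K + ((densityMeasure Φ).real univ * bumpPot 0 - μ.real univ * bumpPot 0) +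
        C * (0 * D * (1 + B) + 0 ^ 4 * D ^ 2) < 0 := by
    rw [hν]
    nlinarith [mul_pos (sub_pos.2 hμ) bumpPot_zero_pos]
  obtain ⟨j, hj⟩ := (hlim.eventually (gt_mem_nhds hlimneg)).exists
  set s := t j
  have hs : 0 < s := ht0 j
  obtain ⟨h, hh, hhB, hhE⟩ := htrial hs (ht1 j)
  set χ : L2 := (trial hs).toLp 2
  -- The projection is subtracted at the level of `f`, so that `‖g‖` measures the correction in
  -- `H¹`.
  set g : L2 := -∑ k, inner ℂ (Φ k) χ • f k with hg
  have hgnorm : ‖g‖ ≤ s ^ 3 * D := by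
    rw [hg, norm_neg, hD, Finset.mul_sum]
    refine (norm_sum_le _ _).trans (Finset.sum_le_sum fun k _ => ?_)
    rw [norm_smul, ← mul_assoc]
    gcongr
    exact norm_inner_trial_le hs (hdec.integrable k)
  have hbg : bessel (h + g) = χ - ∑ k, inner ℂ (Φ k) χ • Φ k := by
    rw [map_add, hh, hg, map_neg, map_sum, sub_eq_add_neg]
    simp_rw [map_smul, hf]
  have horth : ∀ k, inner ℂ (Φ k) (bessel (h + g)) = 0 := fun k => by
    rw [hbg]; exact inner_sub_sum_eq_zero hΦ.2 χ k
  have hneg : energyForm V (h + g) < 0 := by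
    have h1 := (abs_le.1 (hpert h g)).2
    have h2 : ‖g‖ * (1 + ‖h‖ ^ 2) + ‖g‖ ^ 2 ≤ s ^ 3 * D * (1 + B) + (s ^ 3 * D) ^ 2 := by
      gcongr
    have h3 := mul_le_mul_of_nonneg_left h2 hC
    have h4 := mul_neg_of_pos_of_neg (pow_pos hs 2) hj
    have h5 : s ^ 2 * (s ^ 2 * K +
      ((∫ y, bumpPot (s ^ 2 • y) ∂(densityMeasure Φ)) - ∫ y, bumpPot (s ^ 2 • y) ∂μ) +
      C * (s * D * (1 + B) + s ^ 4 * D ^ 2)) = s ^ 4 * K + s ^ 2 *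
      ((∫ y, bumpPot (s ^ 2 • y) ∂(densityMeasure Φ)) - ∫ y, bumpPot (s ^ 2 • y) ∂μ) +
      C * (s ^ 3 * D * (1 + B) + (s ^ 3 * D) ^ 2) := by ring
    rw [h5] at h4
    linarith
  obtain ⟨w, hw, hwneg⟩ := exists_lumoSet_of_energyForm_neg horth hneg
  exact ⟨bessel w, hw, by rw [excitationEnergy_eq_energyForm]; exact hwneg⟩

end

end KohnSham

end

theorem theorem3p1 (exc : ℝ → ℝ) (hexc : KohnSham.AdmissibleXC exc)
    (Ω : Set KohnSham.E3) (hΩ : IsCompact Ω) (Z : ℝ) (hZ : 0 < Z)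
    (n : ℕ) (hn : 1 ≤ n)
    (μ : MeasureTheory.Measure KohnSham.E3) (hμ : μ ∈ KohnSham.Anuc Ω Z)
    (Φ : Fin n → KohnSham.L2) (hΦ : Φ ∈ KohnSham.orbitalSet n) :
    (∃ φH ∈ KohnSham.homoSet Φ,
      IsMaxOn (KohnSham.excitationEnergy exc μ (KohnSham.density Φ)) (KohnSham.homoSet Φ) φH) ∧
    ((2 * n : ℝ) < Z → KohnSham.ExpDecay Φ →
      ∃ φL ∈ KohnSham.lumoSet Φ,
        IsMinOn (KohnSham.excitationEnergy exc μ (KohnSham.density Φ))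
          (KohnSham.lumoSet Φ) φL) := by
  have hfin : MeasureTheory.IsFiniteMeasure μ := ⟨by rw [hμ.2]; exact ENNReal.ofReal_lt_top⟩
  have hV := KohnSham.isFormSmall_totalPot hexc μ Φ
  have hE := KohnSham.excitationEnergy_eq_energyForm exc μ (KohnSham.density Φ)
  refine ⟨KohnSham.exists_isMaxOn_homoSet hn hΦ hV hE, fun hZn hdec => ?_⟩
  refine KohnSham.exists_isMinOn_lumoSet hV hE (KohnSham.exists_lumoSet_neg hexc μ hΦ ?_ hdec)
  rwa [MeasureTheory.measureReal_def, hμ.2, ENNReal.toReal_ofReal hZ.le]
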